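/- A (finite-dimensional) C*-quantum groupoid, or weak Hopf C*-algebra, is a collection $(A,\Delta,\kappa,\epsilon)$ where $A$ is a finite-dimensional C*-algebra with unit; $\Delta:A\to A\otimes A$ is a (not necessarily unital) *-homomorphism with $(\Delta\otimes i)\Delta=(i\otimes\Delta)\Delta$; $\kappa:A\to A$ is linear with $(\kappa\circ *)^2=i$, $\kappa(xy)=\kappa(y)\kappa(x)$ and $(\kappa\otimes\kappa)\Delta=\varsigma\Delta\kappa$ ($\varsigma$ the flip), such that $(m(\kappa\otimes i)\otimes i)(\Delta\otimes i)\Delta(x)=(1\otimes x)\Delta(1)$ for all $x\in A$ ($m$ the multiplication); and $\epsilon$ is a positive linear form on $A$ with $(\epsilon\otimes i)\Delta=(i\otimes\epsilon)\Delta=i$ and $(\epsilon\otimes\epsilon)((x\otimes 1)\Delta(1)(1\otimes y))=\epsilon(xy)$ for all $x,y\in A$. Its target and source Cartan subalgebras are $$A_t=\{x\in A:\Delta(x)=\Delta(1)(x\otimes 1)=(x\otimes 1)\Delta(1)\},\qquad A_s=\{x\in A:\Delta(x)=\Delta(1)(1\otimes x)=(1\otimes x)\Delta(1)\}.$$ For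 matrix units $(e^\gamma_{i,j})_{1\le i,j\le n_\gamma}$ of the C*-algebra $A_t$ (in particular $(e^\gamma_{i,j})^*=e^\gamma_{j,i}$), write $E(x)=\sum_{\gamma,i,j}\frac1{n_\gamma}e^\gamma_{i,j}\,x\,e^\gamma_{j,i}$ for the canonical conditional expectation of $A_t$ onto its center. Call an invertible element $q\in A_t$ canonical if $$\Delta(1)=\sum_{\gamma,i,j}\frac1{n_\gamma}\,\kappa^{-1}(e^\gamma_{i,j}q)\otimes e^\gamma_{j,i}$$ for every system of matrix units $(e^\gamma_{i,j})$ of $A_t$. Given a canonical $q$, call a positive invertible element $k\in A_t$ admissible if $\kappa^2(k)=k$ and $E(k^{-1}q)=1$. The deformation of $(A,\Delta,\kappa,\epsilon)$ by such a $k$ is the algebra $A$ with the involution $a^{*_k}=ka^*k^{-1}$ and $$\Delta_k(a)=\Delta(a)(1\otimes k^{-1}),\qquad \kappa_k(a)=k\,\kappa(a)\,k^{-1},\qquad \epsilon_k(a)=\epsilon(ak).$$ **Corollary.** Every finite-dimensional C*-quantum groupoid $(A,\Delta,\kappa,\epsilon)$ can be deformed in such a way that the antipode becomes involutive on the Cartan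 subalgebras. Precisely: there is a unique canonical element $q$; it is positive and $k=q$ is admissible; the deformation $(A_q,\Delta_q,\kappa_q,\epsilon_q)$, where $A_q$ is the algebra $A$ with the involution $*_q$, is again a C*-quantum groupoid (in particular $A_q$ is a C*-algebra); its target and source Cartan subalgebras are the same sets $A_t$ and $A_s$; and $\kappa_q^2(x)=x$ for every $x\in A_t$ and every $x\in A_s$. -/

import Mathlib

open scoped TensorProduct ComplexOrder

noncomputable section

/-- A finite-dimensional C*-quantum groupoid (weak Hopf C*-algebra) `(A, Δ, κ, ε)` on the
complex algebra `A`.  The involution is part of the data, so that different C*-quantum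
groupoids can live on the same algebra. -/
structure CStarQuantumGroupoid (A : Type*) [Ring A] [Algebra ℂ A] where
  /-- the involution, conjugate linear by its type -/
  star : A →ₗ⋆[ℂ] A
  star_star : ∀ x, star (star x) = x
  star_mul : ∀ x y, star (x * y) = star y * star x
  /-- `A` is a C*-algebra: it carries a C*-norm (completeness is automatic, as `A` is
  finite-dimensional) -/
  exists_cstarNorm : ∃ ν : AlgebraNorm ℂ A, ∀ x, ν (star x * x) = ν x * ν x
  /-- the coproduct `Δ`, a (not necessarily unital) coassociative *-homomorphism -/
  comul : A →ₗ[ℂ] A ⊗[ℂ] A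
  comul_mul : ∀ x y, comul (x * y) = comul x * comul y
  comul_star : ∀ x, comul (star x) = TensorProduct.map star star (comul x)
  coassoc : ∀ x, TensorProduct.assoc ℂ A A A (TensorProduct.map comul .id (comul x)) =
    TensorProduct.map .id comul (comul x)
  /-- the antipode `κ` -/
  antipode : A →ₗ[ℂ] A
  antipode_star : ∀ x, antipode (star (antipode (star x))) = x
  antipode_mul : ∀ x y, antipode (x * y) = antipode y * antipode x
  antipode_comul : ∀ x, TensorProduct.map antipode antipode (comul x) =
    TensorProduct.comm ℂ A A (comul (antipode x))
  /-- `(m(κ ⊗ i) ⊗ i)(Δ ⊗ i)Δ(x) = (1 ⊗ x)Δ(1)` -/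
  antipode_weak : ∀ x,
    TensorProduct.map (LinearMap.mul' ℂ A ∘ₗ TensorProduct.map antipode .id) .id
      (TensorProduct.map comul .id (comul x)) = (1 ⊗ₜ[ℂ] x) * comul 1
  /-- the counit `ε` -/
  counit : A →ₗ[ℂ] ℂ
  counit_nonneg : ∀ x, 0 ≤ counit (star x * x)
  counit_left : ∀ x, TensorProduct.lid ℂ A (TensorProduct.map counit .id (comul x)) = x
  counit_right : ∀ x, TensorProduct.rid ℂ A (TensorProduct.map .id counit (comul x)) = x
  /-- `(ε ⊗ ε)((x ⊗ 1)Δ(1)(1 ⊗ y)) = ε(xy)` -/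
  counit_weak : ∀ x y,
    TensorProduct.lid ℂ ℂ (TensorProduct.map counit counit
      ((x ⊗ₜ[ℂ] 1) * comul 1 * (1 ⊗ₜ[ℂ] y))) = counit (x * y)

/-- A system of matrix units `e γ i j` for a sub-C*-algebra `N ∋ 1` of the algebra `A` with
involution `st`: it exhibits `N` as a direct sum of full matrix algebras of sizes `n γ`. -/
structure MatrixUnits {A : Type*} [Ring A] [Algebra ℂ A] (st : A → A) (N : Set A) where
  /-- the number of blocks -/
  m : ℕ
  /-- the sizes of the blocks -/
  n : Fin m → ℕ
  n_pos : ∀ γ, 0 < n γ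
  /-- the matrix units -/
  e : ∀ γ, Fin (n γ) → Fin (n γ) → A
  e_mul_same : ∀ γ i j k l, e γ i j * e γ k l = if j = k then e γ i l else 0
  e_mul_ne : ∀ γ δ i j k l, γ ≠ δ → e γ i j * e δ k l = 0
  e_star : ∀ γ i j, st (e γ i j) = e γ j i
  e_ne_zero : ∀ γ i j, e γ i j ≠ 0
  sum_diag : ∑ γ, ∑ i, e γ i i = 1
  span_eq : (Submodule.span ℂ {x | ∃ γ i j, x = e γ i j} : Set A) = N

/-- The canonical conditional expectation of `N` onto its center,
`x ↦ ∑ (1 / n γ) e γ i j * x * e γ j i`. -/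
def MatrixUnits.centerExp {A : Type*} [Ring A] [Algebra ℂ A] {st : A → A} {N : Set A}
    (E : MatrixUnits st N) (x : A) : A :=
  ∑ γ, ∑ i, ∑ j, (1 / (E.n γ : ℂ)) • (E.e γ i j * x * E.e γ j i)

namespace CStarQuantumGroupoid

variable {A : Type*} [Ring A] [Algebra ℂ A] (G : CStarQuantumGroupoid A)

/-- The target Cartan subalgebra `A_t`. -/
def target : Set A :=
  {x | G.comul x = G.comul 1 * (x ⊗ₜ[ℂ] 1) ∧ G.comul x = (x ⊗ₜ[ℂ] 1) * G.comul 1}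

/-- The source Cartan subalgebra `A_s`. -/
def source : Set A :=
  {x | G.comul x = G.comul 1 * (1 ⊗ₜ[ℂ] x) ∧ G.comul x = (1 ⊗ₜ[ℂ] x) * G.comul 1}

/-- The antipode as a linear bijection; its inverse is `* ∘ κ ∘ *`. -/
def antipodeEquiv : A ≃ₗ[ℂ] A :=
  { G.antipode with
    invFun := fun x => G.star (G.antipode (G.star x))
    left_inv := fun x => by
      have h := G.antipode_star (G.star x)
      rw [G.star_star] at h
      exact (congrArg G.star h).trans (G.star_star x)
    right_inv := fun x => G.antipode_star x }

/-- `q` is the canonical element of `A_t`: `q` is an invertible element of `A_t` and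
`Δ(1) = ∑ (1 / n γ) κ⁻¹(e γ i j * q) ⊗ e γ j i` for any matrix units of `A_t`. -/
def IsCanonicalElement (q : Aˣ) : Prop :=
  (q : A) ∈ G.target ∧
  ∀ E : MatrixUnits G.star G.target,
    G.comul 1 = ∑ γ, ∑ i, ∑ j,
      (1 / (E.n γ : ℂ)) • (G.antipodeEquiv.symm (E.e γ i j * q) ⊗ₜ[ℂ] E.e γ j i)

/-- With `q` the canonical element, `k` is an admissible deformation parameter: a strictly
positive (that is, positive and invertible) element of `A_t` with `κ²(k) = k` and
`E(k⁻¹ q) = 1`, where `E` is the canonical conditional expectation of `A_t` onto its center. -/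
structure IsDeformationParameter (q k : Aˣ) : Prop where
  mem_target : (k : A) ∈ G.target
  positive : ∃ b, (k : A) = G.star b * b
  antipode_sq : G.antipode (G.antipode k) = k
  centerExp_eq_one : ∀ E : MatrixUnits G.star G.target,
    E.centerExp (((k⁻¹ : Aˣ) : A) * (q : A)) = 1

/-- `G'` is the deformation of `G` by `k`: the involution is `a ↦ k a* k⁻¹`, the coproduct
`a ↦ Δ(a)(1 ⊗ k⁻¹)`, the antipode `a ↦ k κ(a) k⁻¹`, and the counit `a ↦ ε(a k)`; the underlying
algebra does not change. -/
structure IsDeformation (k : Aˣ) (G' : CStarQuantumGroupoid A) : Prop where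
  star_eq : ∀ a, G'.star a = k * G.star a * ((k⁻¹ : Aˣ) : A)
  comul_eq : ∀ a, G'.comul a = G.comul a * (1 ⊗ₜ[ℂ] ((k⁻¹ : Aˣ) : A))
  antipode_eq : ∀ a, G'.antipode a = k * G.antipode a * ((k⁻¹ : Aˣ) : A)
  counit_eq : ∀ a, G'.counit a = G.counit (a * k)

end CStarQuantumGroupoid

end

/-! Write `Δ(1) = 1₁ ⊗ 1₂`. Its legs lie in `A_s` and `A_t` (`exists_comul_one_eq_sum`), these
algebras commute, and `(κ(x) ⊗ 1)Δ(1) = (1 ⊗ x)Δ(1)` for `x` in `A_t` (`antipode_mul_comul_one`).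
Hence `P = (κ ⊗ i)Δ(1)` lies in `A_t ⊗ A_t` and satisfies `(x ⊗ 1)P = P(1 ⊗ x)`. The symmetric
separability element `S = ∑ (1/n) e_ij ⊗ e_ji` satisfies `S(x ⊗ 1) = (1 ⊗ x)S`. Playing the two
rules against each other gives `P = S(q ⊗ 1)` with `q = 1₂ κ(1₁)`
(`separability_mul_canonicalElement`), which is the canonical formula; multiplying its legs together
recovers `q`, hence uniqueness.

Applying `ε` to the second leg of `P = S(q ⊗ 1)` gives `q⁻¹ = (i ⊗ ε)(S)`, the density of `ε` on
`A_t` for the trace of the regular representation. Positivity of `ε` therefore yields `q⁻¹ = c* c`,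
and `q` is positive too. Admissibility reduces to `κ²(q) = q` and `E(1) = 1`.

The exchange rule also gives `xq = qκ²(x)` on `A_t`, so `κ²` is conjugation by `q⁻¹` on `A_t` and by
`κ(q)` on `A_s`. Conjugating `κ` by `q` cancels both, because `A_s` and `A_t` commute.

For the deformed axioms, `κ(1₁) q⁻¹ 1₂ = 1` makes `Δ_q` multiplicative and leaves the source
counital map unchanged, while `x ↦ c x c⁻¹` carries the new involution to the old one and so
transports the C*-norm. -/

section ProperStar

/-! ### Matrix units in a finite-dimensional algebra with proper involution. -/

variable {B : Type*} [Ring B] [Algebra ℂ B] [StarRing B]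

/-- A self-adjoint element of a finite-dimensional algebra with proper involution has a
self-adjoint kernel projection. -/
theorem exists_kernel_projection [FiniteDimensional ℂ B]
    (hB : ∀ x : B, star x * x = 0 → x = 0) {a : B} (ha : star a = a) :
    ∃ e r : B, IsStarProjection e ∧ a * e = 0 ∧ e + a * r = 1 := by
  set L : B →ₗ[ℂ] B := LinearMap.mulLeft ℂ a
  have hd : Disjoint (LinearMap.ker L) (LinearMap.range L) := by
    rw [Submodule.disjoint_def]
    rintro _ hx ⟨y, rfl⟩
    have hx' : a * (a * y) = 0 := hx
    apply hB
    change star (a * y) * (a * y) = 0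
    rw [star_mul, ha, mul_assoc, hx', mul_zero]
  have ht : LinearMap.ker L ⊔ LinearMap.range L = ⊤ := by
    apply Submodule.eq_top_of_disjoint _ _ _ hd
    rw [add_comm]
    exact (LinearMap.finrank_range_add_finrank_ker L).ge
  -- Properness makes the kernel and range of left multiplication by `a` complementary; `e` is the
  -- kernel component of `1`.
  obtain ⟨e, he, y, ⟨r, rfl⟩, h1⟩ := Submodule.mem_sup.1 (ht ▸ Submodule.mem_top : (1 : B) ∈ _)
  have he : a * e = 0 := he
  have h1 : e + a * r = 1 := h1
  have h2 : star e * e = e := by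
    have : star e = 1 - star r * a := by
      rw [eq_sub_iff_add_eq]
      have := congrArg star h1
      simpa only [star_add, star_mul, ha, star_one] using this
    rw [this, sub_mul, one_mul, mul_assoc, he, mul_zero, sub_zero]
  have h3 : star e = e := by
    rw [← h2, star_mul, star_star]
  exact ⟨e, r, ⟨by rw [h3] at h2; exact h2, h3⟩, he, h1⟩

/-- A projection `p` with `p B p = ℂ p ≠ 0`. -/
structure IsMinimalProjection (p : B) : Prop where
  isStarProjection : IsStarProjection p
  ne_zero : p ≠ 0
  corner : ∀ x, ∃ c : ℂ, p * x * p = c • p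

/-- If some `p x p` is not a multiple of `p`, subtract an eigenvalue of it on `p B`: the result `g`
is nonzero but kills a nonzero vector of `p B`, so its kernel projection cuts `p` properly. -/
theorem exists_subprojection [FiniteDimensional ℂ B]
    (hB : ∀ x : B, star x * x = 0 → x = 0) {p : B} (hp : IsStarProjection p) (h0 : p ≠ 0)
    (hm : ¬ IsMinimalProjection p) :
    ∃ e : B, IsStarProjection e ∧ e ≠ 0 ∧ e ≠ p ∧ p * e = e ∧ e * p = e := by
  have hpp : p * p = p := hp.isIdempotentElem
  have hps : star p = p := hp.isSelfAdjoint
  have : ∃ x, ∀ c : ℂ, p * x * p ≠ c • p := by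
    by_contra! h
    exact hm ⟨hp, h0, h⟩
  obtain ⟨x, hx⟩ := this
  -- an eigenvector of `p * x * p` in the right ideal generated by `p`
  let R : Submodule ℂ B := LinearMap.range (LinearMap.mulLeft ℂ p)
  have hR : ∀ y ∈ R, p * y = y := by
    rintro _ ⟨y, rfl⟩
    simp [← mul_assoc, hpp]
  let T : R →ₗ[ℂ] R := ((LinearMap.mulLeft ℂ (p * x * p)).comp R.subtype).codRestrict R
    fun y => ⟨x * p * y, by simp [mul_assoc]⟩
  have : Nontrivial R := ⟨⟨⟨p, 1, by simp⟩, 0, fun h => h0 (congrArg Subtype.val h)⟩⟩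
  obtain ⟨c, hc⟩ := Module.End.exists_eigenvalue T
  obtain ⟨y, hy⟩ := hc.exists_hasEigenvector
  have hyc : p * x * p * (y : B) = c • (y : B) := congrArg Subtype.val hy.apply_eq_smul
  have hy0 : (y : B) ≠ 0 := fun h => hy.2 (Subtype.ext h)
  have hpy : p * (y : B) = y := hR _ y.2
  set g : B := p * x * p - c • p with hg
  have hgy : g * (y : B) = 0 := by rw [hg, sub_mul, hyc, smul_mul_assoc, hpy, sub_self]
  have hg0 : g ≠ 0 := fun h => hx c (sub_eq_zero.1 h)
  have hgp : g * p = g := by simp only [hg, sub_mul, smul_mul_assoc, mul_assoc, hpp]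
  obtain ⟨e, r, he, hae, h1⟩ := exists_kernel_projection hB (a := star g * g) (by simp)
  have hee : e * e = e := he.isIdempotentElem
  have hes : star e = e := he.isSelfAdjoint
  have har : star g * g * r = 1 - e := eq_sub_of_add_eq' h1
  -- `1 - e` lies in the range of `g* g`, hence under `p`; this is why `e` commutes with `p`.
  have hpe : p * (1 - e) = 1 - e := by
    rw [← har, ← mul_assoc, ← mul_assoc]
    congr 2
    rw [← hps, ← star_mul, hgp]
  have hep : (1 - e) * p = 1 - e := by
    have := congrArg star hpe
    simpa [hps, hes] using this
  have hpe' : p * e = p - (1 - e) := by rw [← hpe]; noncomm_ring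
  have hep' : e * p = p - (1 - e) := by rw [← hep]; noncomm_ring
  have hcomm : p * e = e * p := hpe'.trans hep'.symm
  refine ⟨p * e, ⟨?_, ?_⟩, ?_, ?_, ?_, ?_⟩
  · change p * e * (p * e) = p * e
    rw [hcomm, mul_assoc, ← mul_assoc p e p, hcomm, mul_assoc e p p, hpp, ← mul_assoc, hee]
  · change star (p * e) = p * e
    rw [star_mul, hes, hps, hcomm]
  · intro h
    have h2 : (1 - e) * (y : B) = 0 := by
      have : 1 - e = star r * (star g * g) := by
        have := congrArg star har
        simpa [hes, mul_assoc] using this.symm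
      rw [this, mul_assoc, mul_assoc, hgy, mul_zero, mul_zero]
    have h3 : p * e * (y : B) = y := by
      rw [hpe', sub_mul, h2, hpy, sub_zero]
    exact hy0 (by rw [← h3, h, zero_mul])
  · intro h
    rw [hpe'] at h
    have : e = 1 := (sub_eq_zero.1 (sub_eq_self.1 h)).symm
    rw [this, mul_one] at hae
    exact hg0 (hB _ hae)
  · rw [← mul_assoc, hpp]
  · rw [mul_assoc, ← hcomm, ← mul_assoc, hpp]

/-- Strong induction on `dim p B`: a nonminimal `p` splits as `e + (p - e)`, both with strictly
smaller right ideals. -/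
theorem exists_sum_minimalProjections [FiniteDimensional ℂ B]
    (hB : ∀ x : B, star x * x = 0 → x = 0) (d : ℕ) :
    ∀ p : B, IsStarProjection p →
      Module.finrank ℂ (LinearMap.range (LinearMap.mulLeft ℂ p)) = d →
      ∃ s : Finset B, (∀ e ∈ s, IsMinimalProjection e) ∧
        (∀ e ∈ s, ∀ f ∈ s, e ≠ f → e * f = 0) ∧ (∀ e ∈ s, e * p = e ∧ p * e = e) ∧
        ∑ e ∈ s, e = p := by
  classical
  induction d using Nat.strong_induction_on with
  | _ d ih =>
    intro p hp hd
    have hpp : p * p = p := hp.isIdempotentElem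
    have hps : star p = p := hp.isSelfAdjoint
    by_cases h0 : p = 0
    · exact ⟨∅, by simp [h0]⟩
    by_cases hm : IsMinimalProjection p
    · exact ⟨{p}, by simp [hm, hpp]⟩
    obtain ⟨e, he, he0, hep, hpe, hep'⟩ := exists_subprojection hB hp h0 hm
    have hee : e * e = e := he.isIdempotentElem
    have hes : star e = e := he.isSelfAdjoint
    have key : ∀ f : B, f * f = f → p * f = f → f * p = f → f ≠ p →
        Module.finrank ℂ (LinearMap.range (LinearMap.mulLeft ℂ f)) < d := by
      intro f hf h1 h2 h3
      rw [← hd]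
      apply Submodule.finrank_lt_finrank_of_lt
      rw [SetLike.lt_iff_le_and_exists]
      refine ⟨?_, p, ⟨1, by simp⟩, ?_⟩
      · rintro _ ⟨y, rfl⟩
        exact ⟨f * y, by simp [← mul_assoc, h1]⟩
      · rintro ⟨y, hy⟩
        apply h3
        have hy : f * y = p := hy
        rw [← h2, ← hy, ← mul_assoc, hf]
    have hff : (p - e) * (p - e) = p - e := by
      simp only [sub_mul, mul_sub, hpp, hpe, hep', hee]; abel
    have hfs : star (p - e) = p - e := by rw [star_sub, hps, hes]
    obtain ⟨s, hs1, hs2, hs3, hs4⟩ := ih _ (key e hee hpe hep' hep) e he rfl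
    obtain ⟨t, ht1, ht2, ht3, ht4⟩ := ih _ (key (p - e) hff (by rw [mul_sub, hpp, hpe])
      (by rw [sub_mul, hpp, hep']) (fun h => he0 (sub_eq_self.1 h))) (p - e) ⟨hff, hfs⟩ rfl
    have hef : e * (p - e) = 0 := by rw [mul_sub, hep', hee, sub_self]
    have hfe : (p - e) * e = 0 := by rw [sub_mul, hpe, hee, sub_self]
    have hst : ∀ x ∈ s, ∀ y ∈ t, x * y = 0 := by
      intro x hx y hy
      rw [← (hs3 x hx).1, ← (ht3 y hy).2, mul_assoc, ← mul_assoc e, hef, zero_mul, mul_zero]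
    have hts : ∀ x ∈ t, ∀ y ∈ s, x * y = 0 := by
      intro x hx y hy
      rw [← (ht3 x hx).1, ← (hs3 y hy).2, mul_assoc, ← mul_assoc (p - e), hfe, zero_mul,
        mul_zero]
    have hdisj : Disjoint s t := by
      rw [Finset.disjoint_left]
      intro x hx hy
      apply (hs1 x hx).ne_zero
      rw [← (hs1 x hx).isStarProjection.isIdempotentElem.eq]
      exact hst x hx x hy
    refine ⟨s ∪ t, ?_, ?_, ?_, ?_⟩
    · intro x hx
      rcases Finset.mem_union.1 hx with hx | hx
      exacts [hs1 x hx, ht1 x hx]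
    · intro x hx y hy hxy
      rcases Finset.mem_union.1 hx with hx | hx <;> rcases Finset.mem_union.1 hy with hy | hy
      exacts [hs2 x hx y hy hxy, hst x hx y hy, hts x hx y hy, ht2 x hx y hy hxy]
    · intro x hx
      rcases Finset.mem_union.1 hx with hx | hx
      · rw [← (hs3 x hx).1, mul_assoc, hep']
        refine ⟨rfl, ?_⟩
        rw [(hs3 x hx).1]
        nth_rewrite 1 [← (hs3 x hx).2]
        rw [← mul_assoc, hpe, (hs3 x hx).2]
      · have h1 : (p - e) * p = p - e := by rw [sub_mul, hpp, hep']
        have h2 : p * (p - e) = p - e := by rw [mul_sub, hpp, hpe]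
        constructor
        · nth_rewrite 1 [← (ht3 x hx).1]
          rw [mul_assoc, h1, (ht3 x hx).1]
        · nth_rewrite 1 [← (ht3 x hx).2]
          rw [← mul_assoc, h2, (ht3 x hx).2]
    · rw [Finset.sum_union hdisj, hs4, ht4, add_sub_cancel]

variable [StarModule ℂ B]

/-- Nonzero corners between minimal projections contain partial isometries. -/
theorem IsMinimalProjection.exists_partialIsometry
    (hB : ∀ x : B, star x * x = 0 → x = 0) {p r : B} (hp : IsMinimalProjection p)
    (hr : IsMinimalProjection r) (hpr : p = r ∨ p * r = 0) {x : B} (hx : p * x * r ≠ 0) :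
    ∃ v : B, p * v = v ∧ v * r = v ∧ star v * v = r ∧ v * star v = p := by
  have hpp : p * p = p := hp.isStarProjection.isIdempotentElem
  have hps : star p = p := hp.isStarProjection.isSelfAdjoint
  have hrr : r * r = r := hr.isStarProjection.isIdempotentElem
  have hrs : star r = r := hr.isStarProjection.isSelfAdjoint
  rcases hpr with rfl | hpr
  · exact ⟨p, by simp [hpp, hps]⟩
  have hrp : r * p = 0 := by
    have := congrArg star hpr
    simpa [hps, hrs] using this
  obtain ⟨w, hw⟩ : ∃ w, w = p * x * r := ⟨_, rfl⟩
  rw [← hw] at hx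
  have hpw : p * w = w := by simp [hw, ← mul_assoc, hpp]
  have hwr : w * r = w := by simp [hw, mul_assoc, hrr]
  have hwp : star w * p = star w := by rw [← hps, ← star_mul, hpw]
  have hrw : r * star w = star w := by
    nth_rewrite 1 [← hrs]
    rw [← star_mul, hwr]
  obtain ⟨c, hc⟩ := hr.corner (star w * w)
  have hc : star w * w = c • r := by
    rw [← hc, ← mul_assoc r, hrw, mul_assoc, hwr]
  have hc0 : c ≠ 0 := by
    rintro rfl
    exact hx (hB _ (by rw [hc, zero_smul]))
  have hcr : star c = c := by
    have h1 : star (star w * w) = star w * w := by simp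
    rw [hc, star_smul, hrs] at h1
    by_contra h
    have h2 : (star c - c) • r = 0 := by rw [sub_smul, h1, sub_self]
    exact hr.ne_zero ((smul_eq_zero.1 h2).resolve_left (sub_ne_zero.2 h))
  obtain ⟨a, rfl⟩ : ∃ a : ℝ, c = a := ⟨c.re, (Complex.conj_eq_iff_re.1 hcr).symm⟩
  have ha : 0 < a := by
    rcases lt_trichotomy a 0 with h | h | h
    · exfalso
      -- otherwise `w + √(-a) r` violates properness
      set b : ℂ := ((Real.sqrt (-a) : ℝ) : ℂ) with hb
      have hbb : b * b = -(a : ℂ) := by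
        rw [hb, ← Complex.ofReal_mul, Real.mul_self_sqrt (by linarith)]
        push_cast; rfl
      have hbs : star b = b := Complex.conj_ofReal _
      have h1 : star w * r = 0 := by rw [← hwp, mul_assoc, hpr, mul_zero]
      have h2 : r * w = 0 := by rw [← hpw, ← mul_assoc, hrp, zero_mul]
      have h3 : w + b • r = 0 := by
        apply hB
        rw [star_add, star_smul, hrs, hbs]
        simp only [add_mul, mul_add, smul_mul_assoc, mul_smul_comm, hc, h1, h2, hrr, smul_smul,
          hbb, smul_zero, add_zero, zero_add]
        rw [← add_smul, add_neg_cancel, zero_smul]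
      have h4 := congrArg (fun y => r * y) h3
      simp only [mul_add, h2, mul_smul_comm, hrr, zero_add, mul_zero] at h4
      rcases smul_eq_zero.1 h4 with h5 | h5
      · rw [h5, mul_zero] at hbb
        exact hc0 (by rw [← neg_eq_zero, hbb])
      · exact hr.ne_zero h5
    · exact absurd (by rw [h]; simp) hc0
    · exact h
  set b : ℂ := ((Real.sqrt a : ℝ) : ℂ) with hb
  have hbb : b * b = (a : ℂ) := by
    rw [hb, ← Complex.ofReal_mul, Real.mul_self_sqrt ha.le]
  have hb0 : b ≠ 0 := by rintro h; rw [h, mul_zero] at hbb; exact hc0 hbb.symm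
  have hbs : star b⁻¹ = b⁻¹ := by rw [star_inv₀]; congr 1; exact Complex.conj_ofReal _
  have hv : star (b⁻¹ • w) * (b⁻¹ • w) = r := by
    rw [star_smul, hbs, smul_mul_smul_comm, hc, smul_smul, ← hbb]
    rw [show b⁻¹ * b⁻¹ * (b * b) = 1 by field_simp, one_smul]
  have hpv : p * (b⁻¹ • w) = b⁻¹ • w := by rw [mul_smul_comm, hpw]
  have hvr : (b⁻¹ • w) * r = b⁻¹ • w := by rw [smul_mul_assoc, hwr]
  generalize b⁻¹ • w = v at hv hpv hvr
  refine ⟨v, hpv, hvr, hv, ?_⟩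
  have hvp : star v * p = star v := by rw [← hps, ← star_mul, hpv]
  -- `v v*` is an idempotent multiple of `p`, and nonzero, so the factor is `1`.
  obtain ⟨d, hd⟩ := hp.corner (v * star v)
  have hd : v * star v = d • p := by
    rw [← hd, ← mul_assoc, hpv, mul_assoc, hvp]
  have h1 : v * star v * (v * star v) = v * star v := by
    rw [mul_assoc, ← mul_assoc (star v), hv, ← mul_assoc, hvr]
  have hd0 : d ≠ 0 := by
    rintro rfl
    rw [zero_smul] at hd
    apply hr.ne_zero
    rw [← hrr]
    nth_rewrite 1 [← hv]
    rw [← hv, mul_assoc, ← mul_assoc v, hd, zero_mul, mul_zero]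
  rw [hd, smul_mul_smul_comm, hpp] at h1
  have h2 : (d * d - d) • p = 0 := by rw [sub_smul, h1, sub_self]
  have h3 : d * (d - 1) = 0 := by
    rw [← (smul_eq_zero.1 h2).resolve_right hp.ne_zero]; ring
  rw [hd, sub_eq_zero.1 ((mul_eq_zero.1 h3).resolve_left hd0), one_smul]

/-- The blocks are the equivalence classes of the `p i` under partial isometries. With `v i` going
from a class representative to `p i`, the matrix units are `v i * star (v j)`. -/
theorem nonempty_matrixUnits_of_minimalProjections
    (hB : ∀ x : B, star x * x = 0 → x = 0) {ι : Type*} [Fintype ι] (p : ι → B)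
    (hp : ∀ i, IsMinimalProjection (p i)) (ho : ∀ i j, i ≠ j → p i * p j = 0)
    (h1 : ∑ i, p i = 1) : Nonempty (MatrixUnits (star : B → B) Set.univ) := by
  classical
  have hpp : ∀ i, p i * p i = p i := fun i => (hp i).isStarProjection.isIdempotentElem
  have hps : ∀ i, star (p i) = p i := fun i => (hp i).isStarProjection.isSelfAdjoint
  have hdich : ∀ i j, p i = p j ∨ p i * p j = 0 := fun i j => by
    by_cases h : i = j
    · exact Or.inl (congrArg p h)
    · exact Or.inr (ho i j h)
  let S : Setoid ι :=
    { r := fun i j => ∃ v : B, p i * v = v ∧ v * p j = v ∧ star v * v = p j ∧ v * star v = p i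
      iseqv :=
        { refl := fun i => ⟨p i, by simp [hpp, hps]⟩
          symm := by
            rintro i j ⟨v, h1, h2, h3, h4⟩
            refine ⟨star v, ?_, ?_, by simpa using h4, by simpa using h3⟩
            · rw [← hps, ← star_mul, h2]
            · rw [← hps, ← star_mul, h1]
          trans := by
            rintro i j k ⟨v, h1, h2, h3, h4⟩ ⟨w, h5, h6, h7, h8⟩
            refine ⟨v * w, by rw [← mul_assoc, h1], by rw [mul_assoc, h6], ?_, ?_⟩
            · rw [star_mul, mul_assoc, ← mul_assoc (star v), h3, h5, h7]
            · rw [star_mul, mul_assoc, ← mul_assoc w, h8, ← mul_assoc, h2, h4] } }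
  have hS : ∀ i j, ∀ x, p i * x * p j ≠ 0 → S.r i j := fun i j x hx =>
    (hp i).exists_partialIsometry hB (hp j) (hdich i j) hx
  choose v hv1 hv2 hv3 hv4 using fun i : ι => S.symm (Quotient.mk_out (s := S) i)
  set rep : ι → ι := fun i => (Quotient.mk S i).out with hrep
  have hv5 : ∀ i, star (v i) * p i = star (v i) := fun i => by
    rw [← hps, ← star_mul, hv1]
  have hvv : ∀ i j, i ≠ j → star (v i) * v j = 0 := fun i j h => by
    rw [← hv5, ← hv1 j, mul_assoc, ← mul_assoc (p i), ho i j h, zero_mul, mul_zero]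
  have hv0 : ∀ i, v i ≠ 0 := fun i h => (hp i).ne_zero (by rw [← hv4, h, zero_mul])
  have hrr : ∀ i j, Quotient.mk S i = Quotient.mk S j → rep i = rep j := fun i j h => by
    simp only [hrep, h]
  let F := Fintype.equivFin (Quotient S)
  let n : Fin (Fintype.card (Quotient S)) → ℕ :=
    fun γ => Fintype.card {i : ι // F (Quotient.mk S i) = γ}
  let I : ∀ γ, Fin (n γ) ≃ {i : ι // F (Quotient.mk S i) = γ} :=
    fun γ => (Fintype.equivFin _).symm
  have hrI : ∀ γ i j, rep (I γ i) = rep (I γ j) := fun γ i j =>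
    hrr _ _ (F.injective ((I γ i).2.trans (I γ j).2.symm))
  refine ⟨
    { m := _
      n := n
      n_pos := fun γ => Fintype.card_pos_iff.2 ⟨⟨(F.symm γ).out, by simp⟩⟩
      e := fun γ i j => v (I γ i) * star (v (I γ j))
      e_mul_same := ?_
      e_mul_ne := ?_
      e_star := fun γ i j => by simp
      e_ne_zero := ?_
      sum_diag := ?_
      span_eq := ?_ }⟩
  · intro γ i j k l
    split_ifs with h
    · subst h
      rw [mul_assoc, ← mul_assoc (star _), hv3]
      change _ * (p (rep (I γ j)) * _) = _
      rw [hrI γ j i, ← mul_assoc]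
      congr 1
      exact hv2 _
    · rw [mul_assoc, ← mul_assoc (star _), hvv, zero_mul, mul_zero]
      exact fun h' => h ((I γ).injective (Subtype.ext h'))
  · intro γ δ i j k l h
    rw [mul_assoc, ← mul_assoc (star _), hvv, zero_mul, mul_zero]
    intro h'
    apply h
    rw [← (I γ j).2, ← (I δ k).2, h']
  · intro γ i j h
    apply hv0 (I γ i)
    have h2 := congrArg (fun x => x * v (I γ j)) h
    simp only [mul_assoc, hv3, zero_mul] at h2
    change v (I γ i) * p (rep (I γ j)) = 0 at h2
    rw [hrI γ j i] at h2
    rw [← h2]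
    exact (hv2 _).symm
  · simp only [hv4]
    rw [← h1, ← Fintype.sum_fiberwise (fun i => F (Quotient.mk S i)) p]
    exact Finset.sum_congr rfl fun γ _ => Equiv.sum_comp (I γ) fun i => p i
  · rw [Set.eq_univ_iff_forall]
    intro x
    -- A nonzero corner `p i * x * p j` forces `i` and `j` into one class; moved to the
    -- representative it becomes a scalar.
    have hx : x = ∑ i, ∑ j, p i * x * p j := by
      simp only [← Finset.mul_sum, ← Finset.sum_mul, h1, one_mul, mul_one]
    rw [hx]
    refine Submodule.sum_mem _ fun i _ => Submodule.sum_mem _ fun j _ => ?_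
    by_cases h0 : p i * x * p j = 0
    · rw [h0]; exact Submodule.zero_mem _
    have hij : Quotient.mk S i = Quotient.mk S j := Quotient.sound (hS i j x h0)
    have hr : rep i = rep j := hrr _ _ hij
    obtain ⟨c, hc⟩ := (hp (rep i)).corner (star (v i) * x * v j)
    have hxe : p i * x * p j = c • (v i * star (v j)) := by
      have h3 : v i * p (rep i) = v i := hv2 i
      have h4 : p (rep i) * star (v j) = star (v j) := by
        rw [hr, ← hps, ← star_mul]
        exact congrArg star (hv2 j)
      calc p i * x * p j = v i * star (v i) * x * (v j * star (v j)) := by rw [hv4, hv4]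
        _ = v i * p (rep i) * star (v i) * x * (v j * (p (rep i) * star (v j))) := by rw [h3, h4]
        _ = v i * (p (rep i) * (star (v i) * x * v j) * p (rep i)) * star (v j) := by
          simp only [mul_assoc]
        _ = _ := by rw [hc, mul_smul_comm, h3, smul_mul_assoc]
    rw [hxe]
    refine Submodule.smul_mem _ _ (Submodule.subset_span
      ⟨F (Quotient.mk S i), (I _).symm ⟨i, by simp⟩, (I _).symm ⟨j, by simp [hij]⟩, ?_⟩)
    simp

theorem nonempty_matrixUnits [FiniteDimensional ℂ B]
    (hB : ∀ x : B, star x * x = 0 → x = 0) :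
    Nonempty (MatrixUnits (star : B → B) Set.univ) := by
  obtain ⟨s, hs1, hs2, -, hs4⟩ := exists_sum_minimalProjections hB _ (1 : B) (.one B) rfl
  refine nonempty_matrixUnits_of_minimalProjections hB (fun e : s => (e : B))
    (fun e => hs1 e e.2) (fun e f h => hs2 e e.2 f f.2 fun h' => h (Subtype.ext h')) ?_
  rw [← hs4]
  exact Finset.sum_coe_sort s fun e => e

end ProperStar

/-! ### Counital maps, Cartan subalgebras and the legs of `Δ(1)`. -/

namespace CStarQuantumGroupoid

variable {A : Type*} [Ring A] [Algebra ℂ A] (G : CStarQuantumGroupoid A)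

theorem star_one : G.star 1 = 1 := by
  have h := G.star_mul (G.star 1) 1
  rwa [mul_one, G.star_star, mul_one, eq_comm] at h

theorem antipode_symm_apply (x : A) :
    G.antipodeEquiv.symm x = G.star (G.antipode (G.star x)) := rfl

@[simp]
theorem antipode_symm_antipode (x : A) : G.antipodeEquiv.symm (G.antipode x) = x :=
  G.antipodeEquiv.symm_apply_apply x

@[simp]
theorem antipode_antipode_symm (x : A) : G.antipode (G.antipodeEquiv.symm x) = x :=
  G.antipodeEquiv.apply_symm_apply x

theorem antipode_injective : Function.Injective G.antipode := G.antipodeEquiv.injective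

theorem antipode_one : G.antipode 1 = 1 := by
  have h := G.antipode_mul (G.antipodeEquiv.symm 1) 1
  rwa [mul_one, antipode_antipode_symm, mul_one, eq_comm] at h

theorem star_antipode (x : A) : G.star (G.antipode x) = G.antipodeEquiv.symm (G.star x) := by
  rw [antipode_symm_apply, G.star_star]

/-- The C*-norm enters the construction of matrix units of `A_t` only through this properness. -/
theorem star_mul_self_eq_zero {x : A} (h : G.star x * x = 0) : x = 0 := by
  obtain ⟨ν, hν⟩ := G.exists_cstarNorm
  have h1 := hν x
  rw [h, map_zero, eq_comm, mul_self_eq_zero] at h1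
  exact ν.eq_zero_of_map_eq_zero' x h1

theorem comul_one_mul (x : A) : G.comul 1 * G.comul x = G.comul x := by
  rw [← G.comul_mul, one_mul]

theorem comul_mul_one (x : A) : G.comul x * G.comul 1 = G.comul x := by
  rw [← G.comul_mul, mul_one]

theorem comul_injective : Function.Injective G.comul := fun x y h => by
  rw [← G.counit_left x, h, G.counit_left]

theorem tensorStar_mul (s t : A ⊗[ℂ] A) : TensorProduct.map G.star G.star (s * t) =
    TensorProduct.map G.star G.star t * TensorProduct.map G.star G.star s := by
  induction s with
  | zero => simp
  | add s₁ s₂ h₁ h₂ => simp only [add_mul, mul_add, map_add, h₁, h₂]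
  | tmul a b =>
    induction t with
    | zero => simp
    | add t₁ t₂ h₁ h₂ => simp only [add_mul, mul_add, map_add, h₁, h₂]
    | tmul c d => simp [G.star_mul]

theorem tensorStar_comul_one :
    TensorProduct.map G.star G.star (G.comul 1) = G.comul 1 := by
  rw [← G.comul_star, G.star_one]

theorem mapAntipode_mul (s t : A ⊗[ℂ] A) :
    TensorProduct.map G.antipode G.antipode (s * t) =
    TensorProduct.map G.antipode G.antipode t * TensorProduct.map G.antipode G.antipode s := by
  induction s with
  | zero => simp
  | add s₁ s₂ h₁ h₂ => simp only [add_mul, mul_add, map_add, h₁, h₂]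
  | tmul a b =>
    induction t with
    | zero => simp
    | add t₁ t₂ h₁ h₂ => simp only [add_mul, mul_add, map_add, h₁, h₂]
    | tmul c d => simp [G.antipode_mul]

theorem comm_mul (s t : A ⊗[ℂ] A) : TensorProduct.comm ℂ A A (s * t) =
    TensorProduct.comm ℂ A A s * TensorProduct.comm ℂ A A t :=
  map_mul (Algebra.TensorProduct.comm ℂ A A) s t

/-- The source counital map `x ↦ κ(x₁) x₂`. -/
noncomputable def sourceCounital : A →ₗ[ℂ] A :=
  LinearMap.mul' ℂ A ∘ₗ TensorProduct.map G.antipode .id ∘ₗ G.comul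

/-- The target counital map `x ↦ x₁ κ(x₂)`. -/
noncomputable def targetCounital : A →ₗ[ℂ] A :=
  LinearMap.mul' ℂ A ∘ₗ TensorProduct.map .id G.antipode ∘ₗ G.comul

theorem map_sourceCounital_comul (x : A) :
    TensorProduct.map G.sourceCounital .id (G.comul x) = (1 ⊗ₜ[ℂ] x) * G.comul 1 := by
  rw [← G.antipode_weak x, TensorProduct.map_map]
  rfl

/-- The values of the source counital map become slices of `Δ(1)`, so they lie where its left leg
lies. -/
theorem sourceCounital_eq_slice (x : A) : G.sourceCounital x =
    TensorProduct.rid ℂ A (TensorProduct.map .id G.counit ((1 ⊗ₜ[ℂ] x) * G.comul 1)) := by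
  have h : ∀ t : A ⊗[ℂ] A, TensorProduct.rid ℂ A (TensorProduct.map .id G.counit
      (TensorProduct.map G.sourceCounital .id t)) =
      G.sourceCounital (TensorProduct.rid ℂ A (TensorProduct.map .id G.counit t)) := by
    intro t
    induction t with
    | zero => simp
    | add s t hs ht => simp only [map_add, hs, ht]
    | tmul a b => simp
  rw [← map_sourceCounital_comul, h, G.counit_right]

/-- `κ` reverses products and flips `Δ`, so it exchanges the two counital maps; this carries the
weak antipode axiom to the target side. -/
theorem antipode_sourceCounital (x : A) :
    G.antipode (G.sourceCounital x) = G.targetCounital (G.antipode x) := by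
  have h : ∀ t : A ⊗[ℂ] A,
      G.antipode (LinearMap.mul' ℂ A (TensorProduct.map G.antipode .id t)) =
      LinearMap.mul' ℂ A (TensorProduct.map .id G.antipode
        (TensorProduct.comm ℂ A A (TensorProduct.map G.antipode G.antipode t))) := by
    intro t
    induction t with
    | zero => simp
    | add s t hs ht => simp only [map_add, hs, ht]
    | tmul a b => simp [G.antipode_mul]
  have h2 := h (G.comul x)
  rw [G.antipode_comul] at h2
  refine h2.trans ?_
  simp [targetCounital]

theorem map_targetCounital_comul (y : A) :
    TensorProduct.map .id G.targetCounital (G.comul y) = G.comul 1 * (y ⊗ₜ[ℂ] 1) := by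
  obtain ⟨x, rfl⟩ := G.antipodeEquiv.surjective y
  change TensorProduct.map .id G.targetCounital (G.comul (G.antipode x)) =
    G.comul 1 * (G.antipode x ⊗ₜ[ℂ] 1)
  have h : ∀ t : A ⊗[ℂ] A, TensorProduct.map .id G.targetCounital
      (TensorProduct.comm ℂ A A (TensorProduct.map G.antipode G.antipode t)) =
      TensorProduct.comm ℂ A A (TensorProduct.map G.antipode G.antipode
        (TensorProduct.map G.sourceCounital .id t)) := by
    intro t
    induction t with
    | zero => simp
    | add s t hs ht => simp only [map_add, hs, ht]
    | tmul a b => simp [antipode_sourceCounital]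
  have hcc : ∀ t : A ⊗[ℂ] A,
      TensorProduct.comm ℂ A A (TensorProduct.comm ℂ A A t) = t := fun t => by simp
  have h2 := h (G.comul x)
  rw [G.antipode_comul, hcc, map_sourceCounital_comul, mapAntipode_mul, G.antipode_comul, comm_mul,
    hcc] at h2
  rw [h2]
  simp [G.antipode_one]

/-- `1₁ ⊗ Δ(1₂) = 1₁ ⊗ Δ(1)(1₂ ⊗ 1)`. -/
theorem map_comul_comul_one :
    TensorProduct.map .id G.comul (G.comul 1) =
      TensorProduct.map .id (LinearMap.mulLeft ℂ (G.comul 1) ∘ₗ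
        (TensorProduct.mk ℂ A A).flip 1) (G.comul 1) := by
  have h := congrArg (TensorProduct.map .id (TensorProduct.map .id G.targetCounital))
    (G.coassoc 1)
  have h1 : ∀ t : A ⊗[ℂ] A, TensorProduct.map .id (TensorProduct.map .id G.targetCounital)
      (TensorProduct.assoc ℂ A A A (TensorProduct.map G.comul .id t)) =
      TensorProduct.assoc ℂ A A A (TensorProduct.map G.comul .id
        (TensorProduct.map .id G.targetCounital t)) := by
    intro t
    induction t with
    | zero => simp
    | add s t hs ht => simp only [map_add, hs, ht]
    | tmul a b =>
      simp only [TensorProduct.map_tmul, LinearMap.id_apply]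
      induction G.comul a with
      | zero => simp
      | add s t hs ht => simp only [map_add, hs, ht, TensorProduct.add_tmul]
      | tmul c d => simp
  -- `i ⊗ ε_t`, with `ε_t` the target counital map, fixes `Δ(1)`. Applied to the last leg in
  -- coassociativity it leaves one side alone and simplifies the other.
  have h2 : TensorProduct.map .id G.targetCounital (G.comul 1) = G.comul 1 := by
    rw [map_targetCounital_comul, ← Algebra.TensorProduct.one_def, mul_one]
  rw [h1, h2, G.coassoc, TensorProduct.map_map] at h
  rw [h]
  congr 2
  ext y
  exact G.map_targetCounital_comul y

/-- The adjoint of `map_comul_comul_one`; slicing the two gives the two conditions defining `A_t`.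
-/
theorem map_comul_comul_one' :
    TensorProduct.map .id G.comul (G.comul 1) =
      TensorProduct.map .id (LinearMap.mulRight ℂ (G.comul 1) ∘ₗ
        (TensorProduct.mk ℂ A A).flip 1) (G.comul 1) := by
  have h := congrArg (TensorProduct.map G.star (TensorProduct.map G.star G.star))
    G.map_comul_comul_one
  have h1 : ∀ t : A ⊗[ℂ] A, TensorProduct.map G.star (TensorProduct.map G.star G.star)
      (TensorProduct.map .id G.comul t) =
      TensorProduct.map .id G.comul (TensorProduct.map G.star G.star t) := by
    intro t
    induction t with
    | zero => simp
    | add s t hs ht => simp only [map_add, hs, ht]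
    | tmul a b => simp [G.comul_star]
  have h2 : ∀ t : A ⊗[ℂ] A, TensorProduct.map G.star (TensorProduct.map G.star G.star)
      (TensorProduct.map .id (LinearMap.mulLeft ℂ (G.comul 1) ∘ₗ
        (TensorProduct.mk ℂ A A).flip 1) t) =
      TensorProduct.map .id (LinearMap.mulRight ℂ (G.comul 1) ∘ₗ
        (TensorProduct.mk ℂ A A).flip 1) (TensorProduct.map G.star G.star t) := by
    intro t
    induction t with
    | zero => simp
    | add s t hs ht => simp only [map_add, hs, ht]
    | tmul a b => simp [tensorStar_mul, tensorStar_comul_one, star_one]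
  rwa [h1, h2, tensorStar_comul_one] at h

/-- The target Cartan subalgebra, bundled. -/
def targetSubalgebra : Subalgebra ℂ A where
  carrier := G.target
  mul_mem' := by
    rintro x y ⟨hx, hx'⟩ ⟨hy, hy'⟩
    have h : ((x * y) ⊗ₜ[ℂ] 1 : A ⊗[ℂ] A) = (x ⊗ₜ[ℂ] 1) * (y ⊗ₜ[ℂ] 1) := by simp
    constructor
    · rw [G.comul_mul, hy, ← mul_assoc, G.comul_mul_one, hx, h, mul_assoc]
    · rw [G.comul_mul, hx', mul_assoc, G.comul_one_mul, hy', h, mul_assoc]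
  add_mem' := by
    rintro x y ⟨hx, hx'⟩ ⟨hy, hy'⟩
    constructor
    · rw [map_add, TensorProduct.add_tmul, mul_add, hx, hy]
    · rw [map_add, TensorProduct.add_tmul, add_mul, hx', hy']
  algebraMap_mem' := by
    intro c
    constructor <;> simp [Algebra.algebraMap_eq_smul_one, ← TensorProduct.smul_tmul',
      ← Algebra.TensorProduct.one_def]

@[simp]
theorem mem_targetSubalgebra {x : A} : x ∈ G.targetSubalgebra ↔ x ∈ G.target := Iff.rfl

/-- The source Cartan subalgebra, as a submodule. -/
def sourceSubmodule : Submodule ℂ A where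
  carrier := G.source
  zero_mem' := by constructor <;> simp
  add_mem' := by
    rintro x y ⟨hx, hx'⟩ ⟨hy, hy'⟩
    constructor
    · rw [map_add, TensorProduct.tmul_add, mul_add, hx, hy]
    · rw [map_add, TensorProduct.tmul_add, add_mul, hx', hy']
  smul_mem' := by
    rintro c x ⟨hx, hx'⟩
    constructor
    · rw [map_smul, TensorProduct.tmul_smul, mul_smul_comm, hx]
    · rw [map_smul, TensorProduct.tmul_smul, smul_mul_assoc, hx']

theorem star_mem_target {x : A} (hx : x ∈ G.target) : G.star x ∈ G.target := by
  obtain ⟨h, h'⟩ := hx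
  constructor
  · rw [G.comul_star, h', tensorStar_mul, tensorStar_comul_one]
    simp [G.star_one]
  · rw [G.comul_star, h, tensorStar_mul, tensorStar_comul_one]
    simp [G.star_one]

theorem comul_antipode (x : A) : G.comul (G.antipode x) =
    TensorProduct.comm ℂ A A (TensorProduct.map G.antipode G.antipode (G.comul x)) := by
  rw [G.antipode_comul]
  simp

theorem comm_map_antipode_comul_one :
    TensorProduct.comm ℂ A A (TensorProduct.map G.antipode G.antipode (G.comul 1)) =
      G.comul 1 := by
  rw [← comul_antipode, antipode_one]

theorem antipode_mem_source {x : A} (hx : x ∈ G.target) : G.antipode x ∈ G.source := by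
  constructor
  · rw [comul_antipode, hx.2, mapAntipode_mul, comm_mul, comm_map_antipode_comul_one]
    simp [antipode_one]
  · rw [comul_antipode, hx.1, mapAntipode_mul, comm_mul, comm_map_antipode_comul_one]
    simp [antipode_one]

theorem antipode_mem_target {x : A} (hx : x ∈ G.source) : G.antipode x ∈ G.target := by
  constructor
  · rw [comul_antipode, hx.2, mapAntipode_mul, comm_mul, comm_map_antipode_comul_one]
    simp [antipode_one]
  · rw [comul_antipode, hx.1, mapAntipode_mul, comm_mul, comm_map_antipode_comul_one]
    simp [antipode_one]

/-- Both `Δ(xy)` and `Δ(yx)` equal `(x ⊗ y)Δ(1)`, and `Δ` is injective. -/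
theorem target_commute_source {x y : A} (hx : x ∈ G.target) (hy : y ∈ G.source) :
    x * y = y * x := by
  apply G.comul_injective
  calc G.comul (x * y) = (x ⊗ₜ[ℂ] 1) * G.comul 1 * ((1 ⊗ₜ[ℂ] y) * G.comul 1) := by
        rw [G.comul_mul, ← hx.2, ← hy.2]
    _ = (x ⊗ₜ[ℂ] 1) * G.comul 1 * (1 ⊗ₜ[ℂ] y) := by
        rw [← hy.2, mul_assoc, G.comul_one_mul, hy.1, mul_assoc]
    _ = (x ⊗ₜ[ℂ] 1) * ((1 ⊗ₜ[ℂ] y) * G.comul 1) := by rw [mul_assoc, ← hy.1, hy.2]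
    _ = (1 ⊗ₜ[ℂ] y) * ((x ⊗ₜ[ℂ] 1) * G.comul 1) := by
        rw [← mul_assoc, ← mul_assoc]
        simp
    _ = G.comul y * G.comul x := by rw [← hx.2, hy.2, mul_assoc, G.comul_one_mul]
    _ = G.comul (y * x) := (G.comul_mul _ _).symm

/-- The right leg of `Δ(1)` lies in the target Cartan subalgebra. -/
theorem slice_comul_one_mem_target (φ : A →ₗ[ℂ] ℂ) :
    TensorProduct.lid ℂ A (TensorProduct.map φ .id (G.comul 1)) ∈ G.target := by
  have h : ∀ (f : A →ₗ[ℂ] A ⊗[ℂ] A) (t : A ⊗[ℂ] A),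
      f (TensorProduct.lid ℂ A (TensorProduct.map φ .id t)) =
      TensorProduct.lid ℂ (A ⊗[ℂ] A) (TensorProduct.map φ .id (TensorProduct.map .id f t)) := by
    intro f t
    induction t with
    | zero => simp
    | add s t hs ht => simp only [map_add, hs, ht]
    | tmul a b => simp
  constructor
  · rw [h, map_comul_comul_one, ← h]; rfl
  · rw [h, map_comul_comul_one', ← h]; rfl

variable [FiniteDimensional ℂ A]

theorem exists_comul_one_eq_sum_target : ∃ (n : ℕ) (u v : Fin n → A),
    G.comul 1 = ∑ k, u k ⊗ₜ[ℂ] v k ∧ ∀ k, v k ∈ G.target := by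
  let b := Module.finBasis ℂ A
  refine ⟨_, b, fun k => TensorProduct.lid ℂ A
    (TensorProduct.map (b.coord k) .id (G.comul 1)), ?_,
    fun k => G.slice_comul_one_mem_target _⟩
  induction G.comul 1 with
  | zero => simp
  | add s t hs ht =>
    simp only [map_add, TensorProduct.tmul_add, Finset.sum_add_distrib, ← hs, ← ht]
  | tmul x y =>
    conv_lhs => rw [← b.sum_repr x, TensorProduct.sum_tmul]
    simp [TensorProduct.smul_tmul]

theorem exists_comul_one_eq_sum : ∃ (n : ℕ) (u v : Fin n → A),
    G.comul 1 = ∑ k, u k ⊗ₜ[ℂ] v k ∧ (∀ k, u k ∈ G.source) ∧ ∀ k, v k ∈ G.target := by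
  obtain ⟨n, u, v, h, hv⟩ := G.exists_comul_one_eq_sum_target
  have h1 := G.antipode_comul 1
  rw [G.antipode_one] at h1
  -- Flipping with `κ` puts the left leg in `κ(A_t) ⊆ A_s`, so source counital values lie in `A_s`.
  have h2 : G.comul 1 = ∑ k, G.antipode (v k) ⊗ₜ[ℂ] G.antipode (u k) := by
    have := congrArg (TensorProduct.comm ℂ A A) h1
    rw [h] at this
    simpa [h] using this.symm
  have hs : ∀ x, G.sourceCounital x ∈ G.source := by
    intro x
    rw [sourceCounital_eq_slice, h2, Finset.mul_sum]
    simp only [Algebra.TensorProduct.tmul_mul_tmul, one_mul, map_sum, TensorProduct.map_tmul,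
      LinearMap.id_apply, TensorProduct.rid_tmul]
    exact G.sourceSubmodule.sum_mem fun k _ => G.sourceSubmodule.smul_mem _
      (G.antipode_mem_source (hv k))
  -- Applying the source counital map to the left leg preserves `Δ(1)`, so both legs are placed in
  -- one and the same expansion.
  refine ⟨n, fun k => G.sourceCounital (u k), v, ?_, fun k => hs _, hv⟩
  have h3 := G.map_sourceCounital_comul 1
  rw [← Algebra.TensorProduct.one_def, one_mul] at h3
  rw [← h3, h]
  simp

theorem sourceCounital_mem_source (x : A) : G.sourceCounital x ∈ G.source := by
  obtain ⟨n, u, v, h, hu, hv⟩ := G.exists_comul_one_eq_sum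
  rw [sourceCounital_eq_slice, h, Finset.mul_sum]
  simp only [Algebra.TensorProduct.tmul_mul_tmul, one_mul, map_sum, TensorProduct.map_tmul,
    LinearMap.id_apply, TensorProduct.rid_tmul]
  exact G.sourceSubmodule.sum_mem fun k _ => G.sourceSubmodule.smul_mem _ (hu k)

end CStarQuantumGroupoid

/-! ### The symmetric separability element of `A_t`. -/

namespace MatrixUnits

variable {A : Type*} [Ring A] [Algebra ℂ A] {st : A → A} {N : Set A} (E : MatrixUnits st N)

theorem e_mem (γ : Fin E.m) (i j : Fin (E.n γ)) : E.e γ i j ∈ N :=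
  E.span_eq.subset (Submodule.subset_span ⟨γ, i, j, rfl⟩)

/-- The symmetric separability element of an algebra with matrix units. -/
noncomputable def separability : A ⊗[ℂ] A :=
  ∑ γ, ∑ i, ∑ j, (1 / (E.n γ : ℂ)) • (E.e γ i j ⊗ₜ[ℂ] E.e γ j i)

theorem sum_e_mul_e :
    ∑ γ, ∑ i, ∑ j, (1 / (E.n γ : ℂ)) • (E.e γ i j * E.e γ j i) = 1 := by
  rw [← E.sum_diag]
  refine Finset.sum_congr rfl fun γ _ => Finset.sum_congr rfl fun i _ => ?_
  have h : (E.n γ : ℂ) ≠ 0 := Nat.cast_ne_zero.2 (E.n_pos γ).ne'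
  simp [E.e_mul_same, ← Nat.cast_smul_eq_nsmul ℂ, smul_smul, h]

theorem sum_e_mul_e' :
    ∑ γ, ∑ i, ∑ j, (1 / (E.n γ : ℂ)) • (E.e γ j i * E.e γ i j) = 1 := by
  rw [← E.sum_e_mul_e]
  exact Finset.sum_congr rfl fun γ _ => Finset.sum_comm

theorem centerExp_one : E.centerExp 1 = 1 := by
  simpa [centerExp] using E.sum_e_mul_e

/-- For `x = e δ k l` both sides are `(1 / n δ) ∑ i, e δ i l ⊗ e δ k i`; the rest is linearity. -/
theorem separability_mul {x : A} (hx : x ∈ N) :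
    E.separability * (x ⊗ₜ[ℂ] 1) = (1 ⊗ₜ[ℂ] x) * E.separability := by
  rw [← E.span_eq] at hx
  induction hx using Submodule.span_induction with
  | zero => simp
  | add x y _ _ hx hy =>
    rw [TensorProduct.add_tmul, TensorProduct.tmul_add, mul_add, add_mul, hx, hy]
  | smul c x _ hx =>
    rw [← TensorProduct.smul_tmul', TensorProduct.tmul_smul, mul_smul_comm, smul_mul_assoc, hx]
  | mem x hx =>
    obtain ⟨δ, k, l, rfl⟩ := hx
    simp only [separability, Finset.sum_mul, Finset.mul_sum, smul_mul_assoc, mul_smul_comm,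
      Algebra.TensorProduct.tmul_mul_tmul, one_mul, mul_one]
    refine Finset.sum_congr rfl fun γ _ => ?_
    by_cases h : γ = δ
    · subst h
      simp only [E.e_mul_same, TensorProduct.ite_tmul, TensorProduct.tmul_ite, smul_ite, smul_zero,
        Finset.sum_ite_eq, Finset.sum_ite_eq', Finset.mem_univ, if_true]
    · simp [E.e_mul_ne _ _ _ _ _ _ h, E.e_mul_ne _ _ _ _ _ _ (Ne.symm h)]

/-- The element of `N` with the given matrix coefficients in each block. -/
def ofMatrix (M : ∀ γ, Matrix (Fin (E.n γ)) (Fin (E.n γ)) ℂ) : A :=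
  ∑ γ, ∑ i, ∑ j, M γ i j • E.e γ i j

theorem ofMatrix_mul (M M' : ∀ γ, Matrix (Fin (E.n γ)) (Fin (E.n γ)) ℂ) :
    E.ofMatrix M * E.ofMatrix M' = E.ofMatrix fun γ => M γ * M' γ := by
  simp only [ofMatrix, Finset.sum_mul]
  refine Finset.sum_congr rfl fun γ _ => Finset.sum_congr rfl fun i _ => ?_
  have h : ∀ j, M γ i j • E.e γ i j * ∑ δ, ∑ k, ∑ l, M' δ k l • E.e δ k l =
      ∑ l, (M γ i j * M' γ j l) • E.e γ i l := by
    intro j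
    rw [Finset.mul_sum, Finset.sum_eq_single γ]
    · simp [Finset.mul_sum, E.e_mul_same, smul_smul, mul_comm]
    · intro δ _ hδ
      simp [Finset.mul_sum, E.e_mul_ne _ _ _ _ _ _ hδ.symm]
    · simp
  simp only [h, Matrix.mul_apply, Finset.sum_smul]
  exact Finset.sum_comm

end MatrixUnits

/-! ### The canonical element: exchange rules, uniqueness, positivity and inverse. -/

namespace CStarQuantumGroupoid

variable {A : Type*} [Ring A] [Algebra ℂ A] (G : CStarQuantumGroupoid A)

/-- Since `Δ(yx) = Δ(y)(x ⊗ 1)`, the source counital map sends `yx` to `κ(x)` times its value at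
`y`. Apply it to the left leg of `Δ(x) = Δ(1)(x ⊗ 1)`. -/
theorem antipode_mul_comul_one {x : A} (hx : x ∈ G.target) :
    (G.antipode x ⊗ₜ[ℂ] 1) * G.comul 1 = (1 ⊗ₜ[ℂ] x) * G.comul 1 := by
  have h : ∀ t : A ⊗[ℂ] A,
      LinearMap.mul' ℂ A (TensorProduct.map G.antipode .id (t * (x ⊗ₜ[ℂ] 1))) =
        G.antipode x * LinearMap.mul' ℂ A (TensorProduct.map G.antipode .id t) := by
    intro t
    induction t with
    | zero => simp
    | add s t hs ht => simp only [map_add, add_mul, mul_add, hs, ht]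
    | tmul a b => simp [G.antipode_mul, mul_assoc]
  have hs : ∀ y, G.sourceCounital (y * x) = G.antipode x * G.sourceCounital y := by
    intro y
    have : G.comul (y * x) = G.comul y * (x ⊗ₜ[ℂ] 1) := by
      rw [G.comul_mul, hx.1, ← mul_assoc, G.comul_mul_one]
    simp only [sourceCounital, LinearMap.comp_apply, this, h]
  have h2 : ∀ t : A ⊗[ℂ] A, TensorProduct.map G.sourceCounital .id (t * (x ⊗ₜ[ℂ] 1)) =
      (G.antipode x ⊗ₜ[ℂ] 1) * TensorProduct.map G.sourceCounital .id t := by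
    intro t
    induction t with
    | zero => simp
    | add s t hs ht => simp only [map_add, add_mul, mul_add, hs, ht]
    | tmul a b => simp [hs]
  rw [← G.map_sourceCounital_comul x, hx.1, h2, map_sourceCounital_comul,
    ← Algebra.TensorProduct.one_def, one_mul]

theorem comul_one_mul_antipode_symm {x : A} (hx : x ∈ G.target) :
    G.comul 1 * (G.antipodeEquiv.symm x ⊗ₜ[ℂ] 1) = G.comul 1 * (1 ⊗ₜ[ℂ] x) := by
  have h := congrArg (TensorProduct.map G.star G.star)
    (G.antipode_mul_comul_one (G.star_mem_target hx))
  simpa [tensorStar_mul, tensorStar_comul_one, star_one, star_antipode, G.star_star] using h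

theorem mul_map_antipode_comul_one {x : A} (hx : x ∈ G.target) :
    (x ⊗ₜ[ℂ] 1) * TensorProduct.map G.antipode .id (G.comul 1) =
      TensorProduct.map G.antipode .id (G.comul 1) * (1 ⊗ₜ[ℂ] x) := by
  have h : ∀ (t : A ⊗[ℂ] A) (y z : A), TensorProduct.map G.antipode .id (t * (y ⊗ₜ[ℂ] z)) =
      (G.antipode y ⊗ₜ[ℂ] 1) * TensorProduct.map G.antipode .id t * (1 ⊗ₜ[ℂ] z) := by
    intro t y z
    induction t with
    | zero => simp
    | add s t hs ht => simp only [map_add, add_mul, mul_add, hs, ht]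
    | tmul a b => simp [G.antipode_mul]
  have h2 := congrArg (TensorProduct.map G.antipode .id) (G.comul_one_mul_antipode_symm hx)
  simpa [h, antipode_one, ← Algebra.TensorProduct.one_def] using h2

/-- `A_t` is a unital *-subalgebra and inherits the proper involution. -/
theorem exists_matrixUnits [FiniteDimensional ℂ A] :
    Nonempty (MatrixUnits G.star G.target) := by
  let N := G.targetSubalgebra
  let _ : StarRing N :=
    { star := fun x => ⟨G.star x, G.star_mem_target x.2⟩
      star_involutive := fun x => Subtype.ext (G.star_star x)
      star_mul := fun x y => Subtype.ext (G.star_mul x y)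
      star_add := fun x y => Subtype.ext (map_add G.star (x : A) y) }
  have : StarModule ℂ N := ⟨fun c x => Subtype.ext (map_smulₛₗ G.star c (x : A))⟩
  obtain ⟨E⟩ := nonempty_matrixUnits (B := N) fun x hx =>
    Subtype.ext (G.star_mul_self_eq_zero (congrArg Subtype.val hx))
  refine ⟨
    { m := E.m
      n := E.n
      n_pos := E.n_pos
      e := fun γ i j => E.e γ i j
      e_mul_same := fun γ i j k l => ?_
      e_mul_ne := fun γ δ i j k l h => congrArg Subtype.val (E.e_mul_ne γ δ i j k l h)
      e_star := fun γ i j => congrArg Subtype.val (E.e_star γ i j)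
      e_ne_zero := fun γ i j h => E.e_ne_zero γ i j (Subtype.ext h)
      sum_diag := ?_
      span_eq := ?_ }⟩
  · have h := congrArg Subtype.val (E.e_mul_same γ i j k l)
    split_ifs at h ⊢ with hjk <;> exact h
  · have h := congrArg N.val E.sum_diag
    simp only [map_sum, map_one] at h
    exact h
  · have h : Submodule.span ℂ {x | ∃ γ i j, x = E.e γ i j} = ⊤ :=
      SetLike.coe_injective E.span_eq
    have h2 := congrArg (Submodule.map N.val.toLinearMap) h
    rw [Submodule.map_span, Submodule.map_top] at h2
    have h3 : (N.val.toLinearMap '' {x | ∃ γ i j, x = E.e γ i j}) =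
        {x : A | ∃ γ i j, x = E.e γ i j} := by
      ext x
      constructor
      · rintro ⟨_, ⟨γ, i, j, rfl⟩, rfl⟩
        exact ⟨γ, i, j, rfl⟩
      · rintro ⟨γ, i, j, rfl⟩
        exact ⟨_, ⟨γ, i, j, rfl⟩, rfl⟩
    rw [h3] at h2
    rw [h2]
    ext x
    simp [N]

/-- The canonical element `1₂ κ(1₁)` of the target Cartan subalgebra. -/
noncomputable def canonicalElement : A :=
  LinearMap.mul' ℂ A (TensorProduct.comm ℂ A A (TensorProduct.map G.antipode .id (G.comul 1)))

/-- Uniqueness: applying `κ ⊗ i`, flipping and multiplying gives `(∑ (1/n) e_ji e_ij) q = q`. -/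
theorem canonicalElement_eq_of_comul_one_eq {E : MatrixUnits G.star G.target} {q : A}
    (h : G.comul 1 = ∑ γ, ∑ i, ∑ j,
      (1 / (E.n γ : ℂ)) • (G.antipodeEquiv.symm (E.e γ i j * q) ⊗ₜ[ℂ] E.e γ j i)) :
    G.canonicalElement = q := by
  rw [canonicalElement, h]
  simp only [map_sum, map_smul, TensorProduct.map_tmul, antipode_antipode_symm,
    LinearMap.id_apply, TensorProduct.comm_tmul, LinearMap.mul'_apply, ← mul_assoc]
  simp only [← smul_mul_assoc (_ : ℂ) (_ * _) q, ← Finset.sum_mul, E.sum_e_mul_e', one_mul]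

theorem canonicalElement_eq_sum {n : ℕ} {u v : Fin n → A}
    (h : G.comul 1 = ∑ k, u k ⊗ₜ[ℂ] v k) :
    G.canonicalElement = ∑ k, v k * G.antipode (u k) := by
  simp [canonicalElement, h]

/-- `1₂ ⊗ 1₁ = κ(1₁) ⊗ κ(1₂)`. -/
theorem sum_antipode_tmul_antipode {n : ℕ} {u v : Fin n → A}
    (h : G.comul 1 = ∑ k, u k ⊗ₜ[ℂ] v k) :
    ∑ k, G.antipode (u k) ⊗ₜ[ℂ] G.antipode (v k) = ∑ k, v k ⊗ₜ[ℂ] u k := by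
  have h1 := G.antipode_comul 1
  rw [antipode_one, h] at h1
  simpa using h1

theorem canonicalElement_eq_sum_antipode {n : ℕ} {u v : Fin n → A}
    (h : G.comul 1 = ∑ k, u k ⊗ₜ[ℂ] v k) :
    G.canonicalElement = ∑ k, G.antipode (u k) * G.antipode (G.antipode (v k)) := by
  have h1 := congrArg (fun t => LinearMap.mul' ℂ A (TensorProduct.map .id G.antipode t))
    (G.sum_antipode_tmul_antipode h)
  rw [G.canonicalElement_eq_sum h]
  simpa using h1.symm

/-- Evaluate `ε ⊗ ε` on `(κ(y) ⊗ 1)Δ(z) = (1 ⊗ y)Δ(z)`. -/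
theorem counit_antipode_mul {y : A} (hy : y ∈ G.target) (z : A) :
    G.counit (G.antipode y * z) = G.counit (y * z) := by
  have h1 : ∀ (a : A) (t : A ⊗[ℂ] A), TensorProduct.lid ℂ ℂ (TensorProduct.map G.counit G.counit
      ((a ⊗ₜ[ℂ] 1) * t)) =
      G.counit (a * TensorProduct.rid ℂ A (TensorProduct.map .id G.counit t)) := by
    intro a t
    induction t with
    | zero => simp
    | add s t hs ht => simp only [map_add, mul_add, hs, ht]
    | tmul b c => simp [mul_comm]
  have h2 : ∀ (a : A) (t : A ⊗[ℂ] A), TensorProduct.lid ℂ ℂ (TensorProduct.map G.counit G.counit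
      ((1 ⊗ₜ[ℂ] a) * t)) =
      G.counit (a * TensorProduct.lid ℂ A (TensorProduct.map G.counit .id t)) := by
    intro a t
    induction t with
    | zero => simp
    | add s t hs ht => simp only [map_add, mul_add, hs, ht]
    | tmul b c => simp
  have h3 := h1 (G.antipode y) (G.comul z)
  rw [← G.comul_one_mul, ← mul_assoc, antipode_mul_comul_one G hy, mul_assoc, G.comul_one_mul,
    h2, G.counit_left, G.counit_right] at h3
  exact h3.symm

theorem counit_mul_antipode_symm {y : A} (hy : y ∈ G.target) (z : A) :
    G.counit (z * G.antipodeEquiv.symm y) = G.counit (z * y) := by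
  have h1 : ∀ (a : A) (t : A ⊗[ℂ] A), TensorProduct.lid ℂ ℂ (TensorProduct.map G.counit G.counit
      (t * (a ⊗ₜ[ℂ] 1))) =
      G.counit (TensorProduct.rid ℂ A (TensorProduct.map .id G.counit t) * a) := by
    intro a t
    induction t with
    | zero => simp
    | add s t hs ht => simp only [map_add, add_mul, hs, ht]
    | tmul b c => simp [mul_comm]
  have h2 : ∀ (a : A) (t : A ⊗[ℂ] A), TensorProduct.lid ℂ ℂ (TensorProduct.map G.counit G.counit
      (t * (1 ⊗ₜ[ℂ] a))) =
      G.counit (TensorProduct.lid ℂ A (TensorProduct.map G.counit .id t) * a) := by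
    intro a t
    induction t with
    | zero => simp
    | add s t hs ht => simp only [map_add, add_mul, hs, ht]
    | tmul b c => simp
  have h3 := h1 (G.antipodeEquiv.symm y) (G.comul z)
  rw [← G.comul_mul_one, mul_assoc, comul_one_mul_antipode_symm G hy, ← mul_assoc,
    G.comul_mul_one, h2, G.counit_left, G.counit_right] at h3
  exact h3.symm

/-- Polarization: positivity at `1 + x` and `1 + i x` makes `ε` hermitian. -/
theorem counit_star (x : A) : G.counit (G.star x) = Star.star (G.counit x) := by
  have h1 := G.counit_nonneg 1
  have h2 := G.counit_nonneg x
  have h3 := G.counit_nonneg (1 + x)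
  have h4 := G.counit_nonneg (1 + Complex.I • x)
  simp only [map_add, map_smulₛₗ, star_one, mul_add, add_mul, one_mul, mul_one, smul_mul_assoc,
    mul_smul_comm, Complex.nonneg_iff, Complex.conj_I, smul_eq_mul] at h1 h2 h3 h4
  simp at h1 h2 h3 h4
  apply Complex.ext
  · simp; linarith
  · simp; linarith

/-- The inverse of the canonical element. -/
noncomputable def canonicalInverse (E : MatrixUnits G.star G.target) : A :=
  E.ofMatrix fun γ => Matrix.of fun i j => (1 / (E.n γ : ℂ)) * G.counit (E.e γ j i)

theorem exists_canonicalInverse_eq (E : MatrixUnits G.star G.target) :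
    ∃ c, G.canonicalInverse E = G.star c * c := by
  have hM : ∀ γ, Matrix.PosSemidef (Matrix.of fun i j =>
      (1 / (E.n γ : ℂ)) * G.counit (E.e γ j i)) := by
    intro γ
    refine .of_dotProduct_mulVec_nonneg ?_ ?_
    · ext i j
      have h := G.counit_star (E.e γ i j)
      rw [E.e_star] at h
      simp [h]
    · intro x
      let i₀ : Fin (E.n γ) := ⟨0, E.n_pos γ⟩
      -- A combination of one row of matrix units realizes the quadratic form as `ε(y* y)`; any row
      -- `i₀` would do.
      have h := G.counit_nonneg (∑ i, Star.star (x i) • E.e γ i₀ i)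
      have h2 : Star.star x ⬝ᵥ (Matrix.of fun i j =>
          (1 / (E.n γ : ℂ)) * G.counit (E.e γ j i)).mulVec x =
          (1 / (E.n γ : ℂ)) * G.counit (G.star (∑ i, Star.star (x i) • E.e γ i₀ i) *
            ∑ i, Star.star (x i) • E.e γ i₀ i) := by
        simp [E.e_star, Finset.sum_mul, Finset.mul_sum, E.e_mul_same, dotProduct, Matrix.mulVec]
        refine Finset.sum_congr rfl fun i _ => Finset.sum_congr rfl fun j _ => ?_
        ring
      rw [h2]
      refine mul_nonneg ?_ h
      positivity
  have hC : ∀ γ, ∃ C : Matrix (Fin (E.n γ)) (Fin (E.n γ)) ℂ, (Matrix.of fun i j =>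
      (1 / (E.n γ : ℂ)) * G.counit (E.e γ j i)) = Star.star C * C := by
    intro γ
    open scoped MatrixOrder Matrix.Norms.L2Operator in
    exact CStarAlgebra.nonneg_iff_eq_star_mul_self.1 (hM γ).nonneg
  choose C hC using hC
  refine ⟨E.ofMatrix C, ?_⟩
  have hs : G.star (E.ofMatrix C) = E.ofMatrix fun γ => Star.star (C γ) := by
    simp only [MatrixUnits.ofMatrix, map_sum, map_smulₛₗ, E.e_star]
    refine Finset.sum_congr rfl fun γ _ => ?_
    rw [Finset.sum_comm]
    rfl
  rw [hs, E.ofMatrix_mul, canonicalInverse]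
  simp only [hC]

variable [FiniteDimensional ℂ A]

theorem canonicalElement_mem_target : G.canonicalElement ∈ G.target := by
  obtain ⟨n, u, v, h, hu, hv⟩ := G.exists_comul_one_eq_sum
  rw [G.canonicalElement_eq_sum h]
  exact G.targetSubalgebra.sum_mem fun k _ =>
    G.targetSubalgebra.mul_mem (hv k) (G.antipode_mem_target (hu k))

theorem antipode_antipode_canonicalElement :
    G.antipode (G.antipode G.canonicalElement) = G.canonicalElement := by
  obtain ⟨n, u, v, h, hu, hv⟩ := G.exists_comul_one_eq_sum
  -- The flip identity becomes `κ²(1₂) κ³(1₁) = κ(1₁) κ²(1₂)`: the left side is `κ²(q)`, the right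
  -- side is `q`.
  have h1 := congrArg (fun t => LinearMap.mul' ℂ A (TensorProduct.comm ℂ A A
    (TensorProduct.map (G.antipode ∘ₗ G.antipode) G.antipode t))) (G.sum_antipode_tmul_antipode h)
  conv_rhs => rw [G.canonicalElement_eq_sum_antipode h]
  rw [G.canonicalElement_eq_sum h]
  simpa [G.antipode_mul] using h1

/-- Apply `κ ⊗ i`, flip and multiply in `(κ(x) ⊗ 1)Δ(1) = (1 ⊗ x)Δ(1)`. -/
theorem mul_canonicalElement {x : A} (hx : x ∈ G.target) :
    x * G.canonicalElement = G.canonicalElement * G.antipode (G.antipode x) := by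
  obtain ⟨n, u, v, h, hu, hv⟩ := G.exists_comul_one_eq_sum
  have h1 := congrArg (fun t => LinearMap.mul' ℂ A (TensorProduct.comm ℂ A A
    (TensorProduct.map G.antipode .id t))) (G.antipode_mul_comul_one hx)
  rw [G.canonicalElement_eq_sum h]
  simpa [h, Finset.mul_sum, Finset.sum_mul, G.antipode_mul, mul_assoc] using h1.symm

variable (E : MatrixUnits G.star G.target)

/-- In `q = 1₂ κ(1₁)`, move `1₂` through the separability element to the second leg. This leaves `P`
between matrix units, and the rule for `P` collects them into `∑ (1/n) e_ij e_ji = 1`. -/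
theorem separability_mul_canonicalElement :
    E.separability * (G.canonicalElement ⊗ₜ[ℂ] 1) =
      TensorProduct.map G.antipode .id (G.comul 1) := by
  obtain ⟨n, u, v, h, hu, hv⟩ := G.exists_comul_one_eq_sum
  set P := TensorProduct.map G.antipode .id (G.comul 1) with hP
  have hPs : P = ∑ k, G.antipode (u k) ⊗ₜ[ℂ] v k := by simp [hP, h]
  calc E.separability * (G.canonicalElement ⊗ₜ[ℂ] 1)
      = ∑ k, (1 ⊗ₜ[ℂ] v k) * E.separability * (G.antipode (u k) ⊗ₜ[ℂ] 1) := by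
        rw [G.canonicalElement_eq_sum h, TensorProduct.sum_tmul, Finset.mul_sum]
        refine Finset.sum_congr rfl fun k _ => ?_
        rw [← E.separability_mul (hv k), mul_assoc]
        simp
    _ = ∑ γ, ∑ i, ∑ j, (1 / (E.n γ : ℂ)) •
          ((E.e γ i j ⊗ₜ[ℂ] 1) * P * (1 ⊗ₜ[ℂ] E.e γ j i)) := by
        simp only [hPs, MatrixUnits.separability, Finset.mul_sum, Finset.sum_mul, Finset.smul_sum,
          mul_smul_comm, smul_mul_assoc, Algebra.TensorProduct.tmul_mul_tmul, one_mul, mul_one]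
        rw [Finset.sum_comm]
        refine Finset.sum_congr rfl fun γ _ => ?_
        rw [Finset.sum_comm]
        exact Finset.sum_congr rfl fun i _ => Finset.sum_comm
    _ = P * (1 ⊗ₜ[ℂ] ∑ γ, ∑ i, ∑ j, (1 / (E.n γ : ℂ)) • (E.e γ i j * E.e γ j i)) := by
        simp only [TensorProduct.tmul_sum, Finset.mul_sum, TensorProduct.tmul_smul, mul_smul_comm,
          hP, G.mul_map_antipode_comul_one (E.e_mem _ _ _), mul_assoc,
          Algebra.TensorProduct.tmul_mul_tmul, one_mul]
    _ = P := by rw [E.sum_e_mul_e, ← Algebra.TensorProduct.one_def, mul_one]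

theorem comul_one_eq_sum_matrixUnits : G.comul 1 = ∑ γ, ∑ i, ∑ j, (1 / (E.n γ : ℂ)) •
    (G.antipodeEquiv.symm (E.e γ i j * G.canonicalElement) ⊗ₜ[ℂ] E.e γ j i) := by
  have h : ∀ t : A ⊗[ℂ] A, TensorProduct.map G.antipodeEquiv.symm.toLinearMap .id
      (TensorProduct.map G.antipode .id t) = t := by
    intro t
    induction t with
    | zero => simp
    | add s t hs ht => simp only [map_add, hs, ht]
    | tmul a b => simp
  rw [← h (G.comul 1), ← G.separability_mul_canonicalElement E]
  simp [MatrixUnits.separability, Finset.sum_mul]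

/-- Apply `ε` to the second leg of the preceding factorization of `(κ ⊗ i)Δ(1)`; one side becomes
`κ(1) = 1`. -/
theorem canonicalInverse_mul_canonicalElement :
    G.canonicalInverse E * G.canonicalElement = 1 := by
  have h1 := congrArg (fun t => TensorProduct.rid ℂ A (TensorProduct.map .id G.counit t))
    (G.separability_mul_canonicalElement E)
  have h2 : ∀ t : A ⊗[ℂ] A, TensorProduct.rid ℂ A (TensorProduct.map .id G.counit
      (TensorProduct.map G.antipode .id t)) =
      G.antipode (TensorProduct.rid ℂ A (TensorProduct.map .id G.counit t)) := by
    intro t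
    induction t with
    | zero => simp
    | add s t hs ht => simp only [map_add, hs, ht]
    | tmul a b => simp
  rw [h2, G.counit_right, antipode_one] at h1
  rw [← h1]
  simp [canonicalInverse, MatrixUnits.ofMatrix, MatrixUnits.separability, Finset.sum_mul,
    smul_smul]

end CStarQuantumGroupoid

/-! ### Properties of the canonical element needed for the deformation. -/

namespace CStarQuantumGroupoid

variable {A : Type*} [Ring A] [Algebra ℂ A] (G : CStarQuantumGroupoid A)

/-- Deformation data: an invertible element `q` of the target Cartan subalgebra together with
the properties that make the deformation of `G` by `q` a C*-quantum groupoid. -/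
structure IsInvolutiveDeformationParameter (q : Aˣ) : Prop where
  mem_target : (q : A) ∈ G.target
  inv_mem_target : ((q⁻¹ : Aˣ) : A) ∈ G.target
  antipode_antipode : G.antipode (G.antipode q) = q
  mul_eq : ∀ x ∈ G.target, x * q = q * G.antipode (G.antipode x)
  comul_one_mul_inv_mul : G.comul 1 * (1 ⊗ₜ[ℂ] ((q⁻¹ : Aˣ) : A)) * G.comul 1 = G.comul 1
  sum_antipode_mul_inv_mul : LinearMap.mul' ℂ A (TensorProduct.map G.antipode
    (LinearMap.mulLeft ℂ ((q⁻¹ : Aˣ) : A)) (G.comul 1)) = 1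
  inv_eq : ∃ c : Aˣ, ((q⁻¹ : Aˣ) : A) = G.star c * c

theorem mul_eq_one_comm_of_finiteDimensional [FiniteDimensional ℂ A] {a b : A}
    (h : a * b = 1) : b * a = 1 := by
  have h1 : LinearMap.mulLeft ℂ a * LinearMap.mulLeft ℂ b = 1 := by
    ext x
    simp [← mul_assoc, h]
  have h2 := LinearMap.congr_fun (mul_eq_one_comm.1 h1) 1
  simpa using h2

/-- The canonical element as a unit. -/
noncomputable def canonicalUnit [FiniteDimensional ℂ A]
    (E : MatrixUnits G.star G.target) : Aˣ where
  val := G.canonicalElement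
  inv := G.canonicalInverse E
  val_inv := mul_eq_one_comm_of_finiteDimensional (G.canonicalInverse_mul_canonicalElement E)
  inv_val := G.canonicalInverse_mul_canonicalElement E

theorem canonicalInverse_mem_target (E : MatrixUnits G.star G.target) :
    G.canonicalInverse E ∈ G.target := by
  rw [← mem_targetSubalgebra, canonicalInverse, MatrixUnits.ofMatrix]
  exact G.targetSubalgebra.sum_mem fun _ _ => G.targetSubalgebra.sum_mem fun _ _ =>
    G.targetSubalgebra.sum_mem fun _ _ => G.targetSubalgebra.smul_mem (E.e_mem _ _ _) _

theorem isInvolutiveDeformationParameter_canonicalUnit [FiniteDimensional ℂ A]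
    (E : MatrixUnits G.star G.target) :
    G.IsInvolutiveDeformationParameter (G.canonicalUnit E) := by
  set q := G.canonicalUnit E with hq
  have hqv : (q : A) = G.canonicalElement := rfl
  have hi : ((q⁻¹ : Aˣ) : A) = G.canonicalInverse E := rfl
  have hmem : (q : A) ∈ G.target := G.canonicalElement_mem_target
  have himem : ((q⁻¹ : Aˣ) : A) ∈ G.target := G.canonicalInverse_mem_target E
  have hs : LinearMap.mul' ℂ A (TensorProduct.map G.antipode
      (LinearMap.mulLeft ℂ ((q⁻¹ : Aˣ) : A)) (G.comul 1)) = 1 := by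
    rw [G.comul_one_eq_sum_matrixUnits E, ← E.sum_e_mul_e, ← hqv]
    simp [mul_assoc]
  refine ⟨hmem, himem, G.antipode_antipode_canonicalElement,
    fun x hx => G.mul_canonicalElement hx, ?_, hs, ?_⟩
  · obtain ⟨n, u, v, h, hu, hv⟩ := G.exists_comul_one_eq_sum
    -- The left leg `u k` of the second `Δ(1)` is absorbed by the first as `κ(u k)` on the right,
    -- leaving `κ(1₁) q⁻¹ 1₂ = 1`.
    have h1 : ∀ k, G.comul 1 * (1 ⊗ₜ[ℂ] ((q⁻¹ : Aˣ) : A)) * (u k ⊗ₜ[ℂ] v k) =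
        G.comul 1 * (1 ⊗ₜ[ℂ] (G.antipode (u k) * (((q⁻¹ : Aˣ) : A) * v k))) := by
      intro k
      have h2 := G.comul_one_mul_antipode_symm (G.antipode_mem_target (hu k))
      rw [antipode_symm_antipode] at h2
      calc _ = G.comul 1 * (u k ⊗ₜ[ℂ] 1) * (1 ⊗ₜ[ℂ] (((q⁻¹ : Aˣ) : A) * v k)) := by
            simp [mul_assoc]
        _ = _ := by rw [h2]; simp [mul_assoc]
    have h3 : ∑ k, G.antipode (u k) * (((q⁻¹ : Aˣ) : A) * v k) = 1 := by
      rw [← hs, h]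
      simp
    nth_rewrite 2 [h]
    rw [Finset.mul_sum]
    simp only [h1]
    rw [← Finset.mul_sum, ← TensorProduct.tmul_sum, h3, ← Algebra.TensorProduct.one_def, mul_one]
  · obtain ⟨c, hc⟩ := G.exists_canonicalInverse_eq E
    have h1 : ((q : A) * G.star c) * c = 1 := by
      rw [mul_assoc, ← hc, ← hi, Units.mul_inv]
    exact ⟨⟨c, q * G.star c, mul_eq_one_comm_of_finiteDimensional h1, h1⟩, hc⟩

namespace IsInvolutiveDeformationParameter

variable {G} {q : Aˣ}

theorem star_inv (hq : G.IsInvolutiveDeformationParameter q) :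
    G.star ((q⁻¹ : Aˣ) : A) = ((q⁻¹ : Aˣ) : A) := by
  obtain ⟨c, hc⟩ := hq.inv_eq
  rw [hc, G.star_mul, G.star_star]

theorem star_eq (hq : G.IsInvolutiveDeformationParameter q) :
    G.star (q : A) = q := by
  have h := congrArg G.star (Units.mul_inv q)
  rw [G.star_mul, hq.star_inv, star_one] at h
  rw [← one_mul (G.star (q : A)), ← Units.mul_inv q, mul_assoc, h, mul_one]

theorem antipode_symm_eq (hq : G.IsInvolutiveDeformationParameter q) :
    G.antipodeEquiv.symm (q : A) = G.antipode q := by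
  apply G.antipode_injective
  rw [antipode_antipode_symm, hq.antipode_antipode]

theorem star_antipode_eq (hq : G.IsInvolutiveDeformationParameter q) :
    G.star (G.antipode (q : A)) = G.antipode q := by
  rw [star_antipode, hq.star_eq, hq.antipode_symm_eq]

end IsInvolutiveDeformationParameter

theorem antipode_inv_mul_antipode (q : Aˣ) :
    G.antipode ((q⁻¹ : Aˣ) : A) * G.antipode (q : A) = 1 := by
  rw [← G.antipode_mul, Units.mul_inv, antipode_one]

end CStarQuantumGroupoid

/-! ### The deformed structure and its axioms. -/

namespace CStarQuantumGroupoid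

variable {A : Type*} [Ring A] [Algebra ℂ A] (G : CStarQuantumGroupoid A)

theorem comul_mul_target {y : A} (hy : y ∈ G.target) (x : A) :
    G.comul (x * y) = G.comul x * (y ⊗ₜ[ℂ] 1) := by
  rw [G.comul_mul, hy.1, ← mul_assoc, G.comul_mul_one]

theorem comul_target_mul {y : A} (hy : y ∈ G.target) (x : A) :
    G.comul (y * x) = (y ⊗ₜ[ℂ] 1) * G.comul x := by
  rw [G.comul_mul, hy.2, mul_assoc, G.comul_one_mul]

theorem antipode_mul_comul {y : A} (hy : y ∈ G.target) (x : A) :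
    (G.antipode y ⊗ₜ[ℂ] 1) * G.comul x = (1 ⊗ₜ[ℂ] y) * G.comul x := by
  rw [← G.comul_one_mul, ← mul_assoc, G.antipode_mul_comul_one hy, mul_assoc]

/-- The deformed involution. -/
def deformedStar (q : Aˣ) : A →ₗ⋆[ℂ] A where
  toFun a := q * G.star a * ((q⁻¹ : Aˣ) : A)
  map_add' a b := by rw [map_add, mul_add, add_mul]
  map_smul' c a := by rw [map_smulₛₗ, mul_smul_comm, smul_mul_assoc]

/-- The deformed coproduct. -/
noncomputable def deformedComul (q : Aˣ) : A →ₗ[ℂ] A ⊗[ℂ] A :=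
  LinearMap.mulRight ℂ (1 ⊗ₜ[ℂ] ((q⁻¹ : Aˣ) : A)) ∘ₗ G.comul

/-- The deformed antipode. -/
def deformedAntipode (q : Aˣ) : A →ₗ[ℂ] A where
  toFun a := q * G.antipode a * ((q⁻¹ : Aˣ) : A)
  map_add' a b := by rw [map_add, mul_add, add_mul]
  map_smul' c a := by rw [map_smul, mul_smul_comm, smul_mul_assoc]; rfl

/-- The deformed counit. -/
def deformedCounit (q : Aˣ) : A →ₗ[ℂ] ℂ :=
  G.counit ∘ₗ LinearMap.mulRight ℂ (q : A)

section Apply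

variable (q : Aˣ) (a : A)

theorem deformedStar_apply :
    G.deformedStar q a = q * G.star a * ((q⁻¹ : Aˣ) : A) := rfl

theorem deformedComul_apply :
    G.deformedComul q a = G.comul a * (1 ⊗ₜ[ℂ] ((q⁻¹ : Aˣ) : A)) := rfl

theorem deformedAntipode_apply :
    G.deformedAntipode q a = q * G.antipode a * ((q⁻¹ : Aˣ) : A) := rfl

theorem deformedCounit_apply : G.deformedCounit q a = G.counit (a * q) := rfl

end Apply

namespace IsInvolutiveDeformationParameter

variable {G} {q : Aˣ}

/-- With `q⁻¹ = c* c`, conjugation by `c` intertwines the deformed and original involutions, so the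
C*-norm pulls back along it. -/
theorem exists_cstarNorm_deformedStar (hq : G.IsInvolutiveDeformationParameter q) :
    ∃ ν : AlgebraNorm ℂ A, ∀ x, ν (G.deformedStar q x * x) = ν x * ν x := by
  obtain ⟨ν, hν⟩ := G.exists_cstarNorm
  obtain ⟨c, hc⟩ := hq.inv_eq
  let φ : A ≃ₐ[ℂ] A :=
    { toFun := fun a => c * a * ((c⁻¹ : Aˣ) : A)
      invFun := fun a => ((c⁻¹ : Aˣ) : A) * a * c
      left_inv := fun a => by simp [mul_assoc]
      right_inv := fun a => by simp [mul_assoc]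
      map_mul' := fun a b => by simp [mul_assoc]
      map_add' := fun a b => by simp [mul_add, add_mul]
      commutes' := fun z => by simp [Algebra.algebraMap_eq_smul_one] }
  let ν' : AlgebraNorm ℂ A :=
    { toFun := fun a => ν (φ a)
      map_zero' := by simp
      add_le' := fun a b => by rw [map_add]; exact map_add_le_add ν _ _
      neg' := fun a => by rw [map_neg]; exact map_neg_eq_map ν _
      mul_le' := fun a b => by rw [map_mul]; exact map_mul_le_mul ν _ _
      eq_zero_of_map_eq_zero' := fun a ha =>
        (map_eq_zero_iff φ φ.injective).1 (ν.eq_zero_of_map_eq_zero' _ ha)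
      smul' := fun z a => by rw [map_smul]; exact map_smul_eq_mul ν _ _ }
  have hcq : (c : A) * q * G.star c = 1 := by
    have h1 : (q : A) * (G.star c * c) = 1 := by rw [← hc, Units.mul_inv]
    calc (c : A) * q * G.star c = c * (q * (G.star c * c)) * ((c⁻¹ : Aˣ) : A) := by
          simp [mul_assoc]
      _ = 1 := by rw [h1]; simp
  have hci : (c : A) * q = G.star ((c⁻¹ : Aˣ) : A) := by
    have h2 : G.star (c : A) * G.star ((c⁻¹ : Aˣ) : A) = 1 := by
      rw [← G.star_mul, Units.inv_mul, star_one]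
    rw [← mul_one ((c : A) * q), ← h2, ← mul_assoc, hcq, one_mul]
  refine ⟨ν', fun x => ?_⟩
  change ν (φ (G.deformedStar q x * x)) = ν (φ x) * ν (φ x)
  rw [map_mul, ← hν]
  congr 2
  change c * (q * G.star x * ((q⁻¹ : Aˣ) : A)) * ((c⁻¹ : Aˣ) : A) =
    G.star (c * x * ((c⁻¹ : Aˣ) : A))
  rw [G.star_mul, G.star_mul, ← hci, hc]
  simp [mul_assoc]

theorem comul_inv_mul (hq : G.IsInvolutiveDeformationParameter q) (x y : A) :
    G.comul x * (1 ⊗ₜ[ℂ] ((q⁻¹ : Aˣ) : A)) * G.comul y = G.comul (x * y) := by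
  rw [← G.comul_mul_one x, ← G.comul_one_mul y, ← mul_assoc, mul_assoc (G.comul x),
    mul_assoc (G.comul x), hq.comul_one_mul_inv_mul, mul_assoc, G.comul_one_mul, ← G.comul_mul]

theorem map_deformedStar (t : A ⊗[ℂ] A) :
    TensorProduct.map (G.deformedStar q) (G.deformedStar q) t =
      ((q : A) ⊗ₜ[ℂ] (q : A)) * TensorProduct.map G.star G.star t *
        (((q⁻¹ : Aˣ) : A) ⊗ₜ[ℂ] ((q⁻¹ : Aˣ) : A)) := by
  induction t with
  | zero => simp
  | add s t hs ht => simp only [map_add, mul_add, add_mul, hs, ht]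
  | tmul a b => simp [deformedStar_apply]

theorem map_deformedAntipode (t : A ⊗[ℂ] A) :
    TensorProduct.map (G.deformedAntipode q) (G.deformedAntipode q) t =
      ((q : A) ⊗ₜ[ℂ] (q : A)) * TensorProduct.map G.antipode G.antipode t *
        (((q⁻¹ : Aˣ) : A) ⊗ₜ[ℂ] ((q⁻¹ : Aˣ) : A)) := by
  induction t with
  | zero => simp
  | add s t hs ht => simp only [map_add, mul_add, add_mul, hs, ht]
  | tmul a b => simp [deformedAntipode_apply]

theorem deformedComul_star (hq : G.IsInvolutiveDeformationParameter q) (x : A) :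
    G.deformedComul q (G.deformedStar q x) =
      TensorProduct.map (G.deformedStar q) (G.deformedStar q) (G.deformedComul q x) := by
  rw [map_deformedStar, deformedComul_apply, deformedComul_apply, deformedStar_apply,
    G.comul_mul_target hq.inv_mem_target, G.comul_target_mul hq.mem_target, tensorStar_mul,
    G.comul_star]
  simp only [TensorProduct.map_tmul, star_one, hq.star_inv]
  rw [← mul_assoc ((q : A) ⊗ₜ[ℂ] (q : A)), mul_assoc _ (((q⁻¹ : Aˣ) : A) ⊗ₜ[ℂ] (1 : A))]
  simp

/-- Both iterates are the original one times `1 ⊗ q⁻¹ ⊗ q⁻¹`; on the right this uses `Δ(b q⁻¹) =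
Δ(b)(q⁻¹ ⊗ 1)`. -/
theorem deformedComul_coassoc (hq : G.IsInvolutiveDeformationParameter q) (x : A) :
    TensorProduct.assoc ℂ A A A
      (TensorProduct.map (G.deformedComul q) .id (G.deformedComul q x)) =
    TensorProduct.map .id (G.deformedComul q) (G.deformedComul q x) := by
  set r : A := ((q⁻¹ : Aˣ) : A) with hr
  have h1 : ∀ t : A ⊗[ℂ] A, TensorProduct.map (G.deformedComul q) .id (t * (1 ⊗ₜ[ℂ] r)) =
      TensorProduct.map G.comul .id t * (((1 : A) ⊗ₜ[ℂ] r) ⊗ₜ[ℂ] r) := by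
    intro t
    induction t with
    | zero => simp
    | add s t hs ht => simp only [map_add, add_mul, hs, ht]
    | tmul a b => simp [deformedComul_apply, hr]
  have h2 : ∀ t : A ⊗[ℂ] A, TensorProduct.map .id (G.deformedComul q) (t * (1 ⊗ₜ[ℂ] r)) =
      TensorProduct.map .id G.comul t * ((1 : A) ⊗ₜ[ℂ] (r ⊗ₜ[ℂ] r)) := by
    intro t
    induction t with
    | zero => simp
    | add s t hs ht => simp only [map_add, add_mul, hs, ht]
    | tmul a b =>
      simp [deformedComul_apply, G.comul_mul_target hq.inv_mem_target, hr, mul_assoc]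
  have h3 : ∀ s t : (A ⊗[ℂ] A) ⊗[ℂ] A, TensorProduct.assoc ℂ A A A (s * t) =
      TensorProduct.assoc ℂ A A A s * TensorProduct.assoc ℂ A A A t :=
    map_mul (Algebra.TensorProduct.assoc ℂ ℂ ℂ A A A)
  rw [deformedComul_apply, ← hr, h1, h2, h3, G.coassoc]
  simp

theorem deformedAntipode_comul (hq : G.IsInvolutiveDeformationParameter q) (x : A) :
    TensorProduct.map (G.deformedAntipode q) (G.deformedAntipode q) (G.deformedComul q x) =
      TensorProduct.comm ℂ A A (G.deformedComul q (G.deformedAntipode q x)) := by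
  have h := congrArg (TensorProduct.comm ℂ A A)
    (G.antipode_mul_comul hq.inv_mem_target (G.antipode x))
  simp only [comm_mul, TensorProduct.comm_tmul] at h
  rw [map_deformedAntipode, deformedComul_apply, deformedComul_apply, mapAntipode_mul,
    G.antipode_comul, deformedAntipode_apply, G.comul_mul_target hq.inv_mem_target,
    G.comul_target_mul hq.mem_target]
  simp only [comm_mul, TensorProduct.comm_tmul, TensorProduct.map_tmul, antipode_one]
  rw [h, ← mul_assoc, mul_assoc _ ((1 : A) ⊗ₜ[ℂ] ((q⁻¹ : Aˣ) : A))]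
  simp

/-- Both outer factors `q` in `ε(q x* q⁻¹ x q)` may be replaced by the self-adjoint `κ(q)`; with
`q⁻¹ = c* c` this is `ε(y* y)` for `y = c x κ(q)`. -/
theorem deformedCounit_nonneg (hq : G.IsInvolutiveDeformationParameter q) (x : A) :
    0 ≤ G.deformedCounit q (G.deformedStar q x * x) := by
  obtain ⟨c, hc⟩ := hq.inv_eq
  have h := G.counit_nonneg (c * x * G.antipode q)
  have h1 : G.deformedCounit q (G.deformedStar q x * x) =
      G.counit (G.star (c * x * G.antipode q) * (c * x * G.antipode q)) := by
    rw [deformedCounit_apply, deformedStar_apply, ← G.counit_mul_antipode_symm hq.mem_target,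
      hq.antipode_symm_eq, mul_assoc, mul_assoc, mul_assoc,
      ← G.counit_antipode_mul hq.mem_target, G.star_mul, G.star_mul, hq.star_antipode_eq, hc]
    simp only [mul_assoc]
  rwa [h1]

theorem deformedCounit_left (hq : G.IsInvolutiveDeformationParameter q) (x : A) :
    TensorProduct.lid ℂ A (TensorProduct.map (G.deformedCounit q) .id (G.deformedComul q x)) =
      x := by
  have h : ∀ t : A ⊗[ℂ] A, TensorProduct.lid ℂ A (TensorProduct.map (G.deformedCounit q) .id
      (t * (1 ⊗ₜ[ℂ] ((q⁻¹ : Aˣ) : A)))) =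
      TensorProduct.lid ℂ A (TensorProduct.map G.counit .id (t * ((q : A) ⊗ₜ[ℂ] 1))) *
        ((q⁻¹ : Aˣ) : A) := by
    intro t
    induction t with
    | zero => simp
    | add s t hs ht => simp only [map_add, add_mul, hs, ht]
    | tmul a b => simp [deformedCounit_apply]
  rw [deformedComul_apply, h, ← G.comul_mul_target hq.mem_target, G.counit_left]
  simp

theorem deformedCounit_right (x : A) :
    TensorProduct.rid ℂ A (TensorProduct.map .id (G.deformedCounit q) (G.deformedComul q x)) =
      x := by
  have h : ∀ t : A ⊗[ℂ] A, TensorProduct.rid ℂ A (TensorProduct.map .id (G.deformedCounit q)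
      (t * (1 ⊗ₜ[ℂ] ((q⁻¹ : Aˣ) : A)))) =
      TensorProduct.rid ℂ A (TensorProduct.map .id G.counit t) := by
    intro t
    induction t with
    | zero => simp
    | add s t hs ht => simp only [map_add, add_mul, hs, ht]
    | tmul a b => simp [deformedCounit_apply]
  rw [deformedComul_apply, h, G.counit_right]

theorem deformedCounit_weak (hq : G.IsInvolutiveDeformationParameter q) (x y : A) :
    TensorProduct.lid ℂ ℂ (TensorProduct.map (G.deformedCounit q) (G.deformedCounit q)
      ((x ⊗ₜ[ℂ] 1) * G.deformedComul q 1 * (1 ⊗ₜ[ℂ] y))) = G.deformedCounit q (x * y) := by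
  have h : ∀ t : A ⊗[ℂ] A, TensorProduct.map (G.deformedCounit q) (G.deformedCounit q) t =
      TensorProduct.map G.counit G.counit (t * ((q : A) ⊗ₜ[ℂ] (q : A))) := by
    intro t
    induction t with
    | zero => simp
    | add s t hs ht => simp only [map_add, add_mul, hs, ht]
    | tmul a b => simp [deformedCounit_apply]
  have h2 : (x ⊗ₜ[ℂ] 1) * G.deformedComul q 1 * (1 ⊗ₜ[ℂ] y) * ((q : A) ⊗ₜ[ℂ] (q : A)) =
      ((x * q) ⊗ₜ[ℂ] 1) * G.comul 1 * (1 ⊗ₜ[ℂ] (((q⁻¹ : Aˣ) : A) * y * q)) := by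
    calc (x ⊗ₜ[ℂ] 1) * G.deformedComul q 1 * (1 ⊗ₜ[ℂ] y) * ((q : A) ⊗ₜ[ℂ] (q : A))
        = (x ⊗ₜ[ℂ] 1) * (G.comul 1 * ((q : A) ⊗ₜ[ℂ] 1)) *
            (1 ⊗ₜ[ℂ] (((q⁻¹ : Aˣ) : A) * y * q)) := by
          simp [deformedComul_apply, mul_assoc]
      _ = _ := by
          rw [← hq.mem_target.1, hq.mem_target.2, ← mul_assoc]
          simp
  rw [h, h2, G.counit_weak, deformedCounit_apply]
  simp [mul_assoc]

theorem deformedAntipode_star (hq : G.IsInvolutiveDeformationParameter q) (x : A) :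
    G.deformedAntipode q (G.deformedStar q (G.deformedAntipode q (G.deformedStar q x))) = x := by
  have h1 : ∀ z, G.antipode ((q⁻¹ : Aˣ) : A) * (G.antipode (q : A) * z) = z := fun z => by
    rw [← mul_assoc, antipode_inv_mul_antipode, one_mul]
  have h2 : G.deformedStar q (G.deformedAntipode q (G.deformedStar q x)) =
      G.antipode q * G.star (G.antipode (G.star x)) * G.star (G.antipode ((q⁻¹ : Aˣ) : A)) := by
    simp only [deformedAntipode_apply, deformedStar_apply, G.antipode_mul, G.star_mul, hq.star_eq,
      hq.star_inv, hq.star_antipode_eq]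
    simp [mul_assoc]
  have h3 : G.antipode (G.star (G.antipode ((q⁻¹ : Aˣ) : A))) = ((q⁻¹ : Aˣ) : A) := by
    rw [star_antipode, hq.star_inv, antipode_antipode_symm]
  rw [h2, deformedAntipode_apply, G.antipode_mul, G.antipode_mul, h3, hq.antipode_antipode,
    G.antipode_star]
  simp

theorem isUnit_one_tmul_inv :
    IsUnit ((1 : A) ⊗ₜ[ℂ] ((q⁻¹ : Aˣ) : A)) :=
  (q⁻¹).isUnit.map (Algebra.TensorProduct.includeRight : A →ₐ[ℂ] A ⊗[ℂ] A)

theorem antipode_antipode_of_mem_target (hq : G.IsInvolutiveDeformationParameter q) {x : A}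
    (hx : x ∈ G.target) : G.antipode (G.antipode x) = ((q⁻¹ : Aˣ) : A) * x * q := by
  rw [mul_assoc, hq.mul_eq x hx, ← mul_assoc, Units.inv_mul, one_mul]

/-- Deduced from the formula on `A_t`, because `κ` is injective and maps `A_s` into `A_t`. -/
theorem antipode_antipode_of_mem_source (hq : G.IsInvolutiveDeformationParameter q) {x : A}
    (hx : x ∈ G.source) :
    G.antipode (G.antipode x) = G.antipode q * x * G.antipode ((q⁻¹ : Aˣ) : A) := by
  apply G.antipode_injective
  rw [hq.antipode_antipode_of_mem_target (G.antipode_mem_target hx), G.antipode_mul,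
    G.antipode_mul, hq.antipode_antipode,
    hq.antipode_antipode_of_mem_target hq.inv_mem_target, Units.inv_mul_cancel_right, ← mul_assoc]

theorem deformedAntipode_deformedAntipode (x : A) :
    G.deformedAntipode q (G.deformedAntipode q x) = q * G.antipode ((q⁻¹ : Aˣ) : A) *
      G.antipode (G.antipode x) * G.antipode q * ((q⁻¹ : Aˣ) : A) := by
  simp only [deformedAntipode_apply, G.antipode_mul, mul_assoc]

/-- The factors `κ(q⁻¹)` and `κ(q)` lie in `A_s`, so they commute past `κ²(x)` and cancel; the outer
`q` undoes `κ²`. -/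
theorem deformedAntipode_deformedAntipode_of_mem_target
    (hq : G.IsInvolutiveDeformationParameter q) {x : A} (hx : x ∈ G.target) :
    G.deformedAntipode q (G.deformedAntipode q x) = x := by
  have h := G.target_commute_source
    (G.targetSubalgebra.mul_mem (G.targetSubalgebra.mul_mem hq.inv_mem_target hx) hq.mem_target)
    (G.antipode_mem_source hq.inv_mem_target)
  rw [deformedAntipode_deformedAntipode, hq.antipode_antipode_of_mem_target hx, mul_assoc (q : A),
    ← h, ← mul_assoc (q : A), mul_assoc _ (G.antipode _) (G.antipode _),
    antipode_inv_mul_antipode]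
  simp [mul_assoc]

theorem deformedAntipode_deformedAntipode_of_mem_source
    (hq : G.IsInvolutiveDeformationParameter q) {x : A} (hx : x ∈ G.source) :
    G.deformedAntipode q (G.deformedAntipode q x) = x := by
  have h1 : ∀ z, G.antipode ((q⁻¹ : Aˣ) : A) * (G.antipode (q : A) * z) = z := fun z => by
    rw [← mul_assoc, antipode_inv_mul_antipode, one_mul]
  rw [deformedAntipode_deformedAntipode, hq.antipode_antipode_of_mem_source hx]
  simp only [mul_assoc, h1]
  rw [← mul_assoc, G.target_commute_source hq.mem_target hx, mul_assoc, Units.mul_inv, mul_one]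

section

variable [FiniteDimensional ℂ A]

/-- Inserting `Δ(x) = Δ(1)Δ(x)` and `κ(1₁) q⁻¹ 1₂ = 1` removes the inner `q⁻¹`; the outer
conjugation by `q` is trivial on `A_s`. -/
theorem sourceCounital_deformed (hq : G.IsInvolutiveDeformationParameter q) :
    LinearMap.mul' ℂ A ∘ₗ TensorProduct.map (G.deformedAntipode q) .id ∘ₗ G.deformedComul q =
      G.sourceCounital := by
  set r : A := ((q⁻¹ : Aˣ) : A) with hr
  have h1 : ∀ t : A ⊗[ℂ] A,
      LinearMap.mul' ℂ A (TensorProduct.map (G.deformedAntipode q) .id (t * (1 ⊗ₜ[ℂ] r))) =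
        q * LinearMap.mul' ℂ A (TensorProduct.map G.antipode (LinearMap.mulLeft ℂ r) t) * r := by
    intro t
    induction t with
    | zero => simp
    | add s t hs ht => simp only [map_add, mul_add, add_mul, hs, ht]
    | tmul a b => simp [deformedAntipode_apply, mul_assoc, hr]
  have h2 : ∀ (s : A ⊗[ℂ] A) (a b : A),
      LinearMap.mul' ℂ A (TensorProduct.map G.antipode (LinearMap.mulLeft ℂ r)
        (s * (a ⊗ₜ[ℂ] b))) = G.antipode a *
      LinearMap.mul' ℂ A (TensorProduct.map G.antipode (LinearMap.mulLeft ℂ r) s) * b := by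
    intro s a b
    induction s with
    | zero => simp
    | add s t hs ht => simp only [map_add, mul_add, add_mul, hs, ht]
    | tmul c d => simp [G.antipode_mul, mul_assoc]
  have h3 : ∀ t : A ⊗[ℂ] A,
      LinearMap.mul' ℂ A (TensorProduct.map G.antipode (LinearMap.mulLeft ℂ r)
        (G.comul 1 * t)) = LinearMap.mul' ℂ A (TensorProduct.map G.antipode .id t) := by
    intro t
    induction t with
    | zero => simp
    | add s t hs ht => simp only [map_add, mul_add, hs, ht]
    | tmul a b =>
      rw [h2, hr, hq.sum_antipode_mul_inv_mul]
      simp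
  ext x
  have h4 := G.target_commute_source hq.mem_target (G.sourceCounital_mem_source x)
  simp only [LinearMap.comp_apply, deformedComul_apply]
  rw [← hr, h1, ← G.comul_one_mul, h3]
  change (q : A) * G.sourceCounital x * r = G.sourceCounital x
  rw [h4, mul_assoc, hr, Units.mul_inv, mul_one]

theorem deformedAntipode_weak (hq : G.IsInvolutiveDeformationParameter q) (x : A) :
    TensorProduct.map (LinearMap.mul' ℂ A ∘ₗ TensorProduct.map (G.deformedAntipode q) .id) .id
      (TensorProduct.map (G.deformedComul q) .id (G.deformedComul q x)) =
    (1 ⊗ₜ[ℂ] x) * G.deformedComul q 1 := by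
  have h : ∀ t : A ⊗[ℂ] A, TensorProduct.map G.sourceCounital .id
      (t * (1 ⊗ₜ[ℂ] ((q⁻¹ : Aˣ) : A))) =
      TensorProduct.map G.sourceCounital .id t * (1 ⊗ₜ[ℂ] ((q⁻¹ : Aˣ) : A)) := by
    intro t
    induction t with
    | zero => simp
    | add s t hs ht => simp only [map_add, add_mul, hs, ht]
    | tmul a b => simp
  rw [TensorProduct.map_map, LinearMap.comp_assoc, hq.sourceCounital_deformed, LinearMap.comp_id,
    deformedComul_apply, h, map_sourceCounital_comul, deformedComul_apply, mul_assoc]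

/-- The deformation of `G` by `q`. -/
noncomputable def deform (hq : G.IsInvolutiveDeformationParameter q) :
    CStarQuantumGroupoid A where
  star := G.deformedStar q
  star_star x := by
    simp only [deformedStar_apply, G.star_mul, G.star_star, hq.star_eq, hq.star_inv]
    simp [mul_assoc]
  star_mul x y := by
    simp only [deformedStar_apply, G.star_mul]
    simp [mul_assoc]
  exists_cstarNorm := hq.exists_cstarNorm_deformedStar
  comul := G.deformedComul q
  comul_mul x y := by
    simp only [deformedComul_apply]
    rw [← mul_assoc, hq.comul_inv_mul]
  comul_star := hq.deformedComul_star
  coassoc := hq.deformedComul_coassoc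
  antipode := G.deformedAntipode q
  antipode_star := hq.deformedAntipode_star
  antipode_mul x y := by
    simp only [deformedAntipode_apply, G.antipode_mul]
    simp [mul_assoc]
  antipode_comul := hq.deformedAntipode_comul
  antipode_weak := hq.deformedAntipode_weak
  counit := G.deformedCounit q
  counit_nonneg := hq.deformedCounit_nonneg
  counit_left := hq.deformedCounit_left
  counit_right := deformedCounit_right
  counit_weak := hq.deformedCounit_weak

theorem isDeformation_deform (hq : G.IsInvolutiveDeformationParameter q) :
    G.IsDeformation q hq.deform :=
  ⟨fun _ => rfl, fun _ => rfl, fun _ => rfl, fun _ => rfl⟩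

theorem target_deform (hq : G.IsInvolutiveDeformationParameter q) :
    hq.deform.target = G.target := by
  ext x
  change (G.comul x * (1 ⊗ₜ[ℂ] ((q⁻¹ : Aˣ) : A)) =
      G.comul 1 * (1 ⊗ₜ[ℂ] ((q⁻¹ : Aˣ) : A)) * (x ⊗ₜ[ℂ] 1) ∧
    G.comul x * (1 ⊗ₜ[ℂ] ((q⁻¹ : Aˣ) : A)) =
      (x ⊗ₜ[ℂ] 1) * (G.comul 1 * (1 ⊗ₜ[ℂ] ((q⁻¹ : Aˣ) : A)))) ↔
    (G.comul x = G.comul 1 * (x ⊗ₜ[ℂ] 1) ∧ G.comul x = (x ⊗ₜ[ℂ] 1) * G.comul 1)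
  have h : G.comul 1 * (1 ⊗ₜ[ℂ] ((q⁻¹ : Aˣ) : A)) * (x ⊗ₜ[ℂ] 1) =
      G.comul 1 * (x ⊗ₜ[ℂ] 1) * (1 ⊗ₜ[ℂ] ((q⁻¹ : Aˣ) : A)) := by
    simp [mul_assoc]
  rw [h, ← mul_assoc, isUnit_one_tmul_inv.mul_left_inj, isUnit_one_tmul_inv.mul_left_inj]

theorem source_deform (hq : G.IsInvolutiveDeformationParameter q) :
    hq.deform.source = G.source := by
  ext x
  change (G.comul x * (1 ⊗ₜ[ℂ] ((q⁻¹ : Aˣ) : A)) =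
      G.comul 1 * (1 ⊗ₜ[ℂ] ((q⁻¹ : Aˣ) : A)) * (1 ⊗ₜ[ℂ] x) ∧
    G.comul x * (1 ⊗ₜ[ℂ] ((q⁻¹ : Aˣ) : A)) =
      (1 ⊗ₜ[ℂ] x) * (G.comul 1 * (1 ⊗ₜ[ℂ] ((q⁻¹ : Aˣ) : A)))) ↔ x ∈ G.source
  rw [← mul_assoc (1 ⊗ₜ[ℂ] x), isUnit_one_tmul_inv.mul_left_inj]
  constructor
  -- One condition suffices: slicing `Δ(x) = (1 ⊗ x)Δ(1)` with `ε` shows that `x` is its own source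
  -- counital value.
  · rintro ⟨-, h⟩
    have h1 := G.counit_right x
    rw [h, ← CStarQuantumGroupoid.sourceCounital_eq_slice] at h1
    exact h1 ▸ G.sourceCounital_mem_source x
  · intro h
    refine ⟨?_, h.2⟩
    rw [h.1, mul_assoc, mul_assoc]
    simp [G.target_commute_source hq.inv_mem_target h]

end

end IsInvolutiveDeformationParameter

end CStarQuantumGroupoid

theorem corollary2p7 {A : Type*} [Ring A] [Algebra ℂ A] [FiniteDimensional ℂ A]
    (G : CStarQuantumGroupoid A) :
    ∃ q : Aˣ, G.IsCanonicalElement q ∧ (∀ q' : Aˣ, G.IsCanonicalElement q' → q' = q) ∧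
      G.IsDeformationParameter q q ∧
      ∃ G' : CStarQuantumGroupoid A, G.IsDeformation q G' ∧
        G'.target = G.target ∧ G'.source = G.source ∧
        (∀ x ∈ G'.target, G'.antipode (G'.antipode x) = x) ∧
        (∀ x ∈ G'.source, G'.antipode (G'.antipode x) = x) := by
  obtain ⟨E⟩ := G.exists_matrixUnits
  have hq := G.isInvolutiveDeformationParameter_canonicalUnit E
  refine ⟨G.canonicalUnit E, ⟨hq.mem_target, G.comul_one_eq_sum_matrixUnits⟩,
    fun q' h => Units.ext (G.canonicalElement_eq_of_comul_one_eq (h.2 E)).symm,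
    ⟨hq.mem_target, ?_, hq.antipode_antipode, fun F => ?_⟩,
    hq.deform, hq.isDeformation_deform, hq.target_deform, hq.source_deform, ?_, ?_⟩
  · obtain ⟨c, hc⟩ := hq.inv_eq
    -- From `q⁻¹ = c* c` and `q* = q` one gets `(cq)*(cq) = q q⁻¹ q = q`.
    refine ⟨c * G.canonicalUnit E, ?_⟩
    rw [G.star_mul, hq.star_eq, mul_assoc, ← mul_assoc (G.star _), ← hc, Units.inv_mul, mul_one]
  · rw [Units.inv_mul, F.centerExp_one]
  · intro x hx
    rw [hq.target_deform] at hx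
    exact hq.deformedAntipode_deformedAntipode_of_mem_target hx
  · intro x hx
    rw [hq.source_deform] at hx
    exact hq.deformedAntipode_deformedAntipode_of_mem_source hx
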